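/- Let $y_i$ ($i\in\mathbb{Z}$) be indeterminates. For $j\in\mathbb{Z}$ define rational functions $F_{j,k}$ ($k\ge -1$) recursively by $F_{j,-1}=F_{j,0}=1$ and $$F_{j,k+1}=\frac{F_{j-3,k}F_{j+3,k}+M_{j,k}F_{j-1,k}F_{j+1,k}}{F_{j,k-1}}\quad(k\ge 0),\qquad M_{j,k}=\prod_{i=-k}^{k}y_{3i+j}.$$ Let $n\ge 1$ be odd, and let $j,k$ be integers with $j+k$ odd and $k\in\{n,n+1\}$. Then $F_{j,k}$ is a polynomial with integer coefficients in the $y_i$, and there are integers $m_1,\dots,m_{2n}\ge 0$, depending only on $n,j,k$, such that the following holds. Let $(y_i)_{i\in\mathbb{Z}}$ be any family of elements of a field such that $y_{i+2n}=y_i$ for all $i$, $y_1y_2\cdots y_{2n}=1$, and $y_i=-1$ for all $i\in\{2,4,\dots,2n-2\}$ (no condition if $n=1$). Then the value of $F_{j,k}$ at $(y_i)$ is $$F_{j,k}=\begin{cases} y_1^{m_1}\cdots y_{2n}^{m_{2n}}\,(1+y_0)^{n}, & k=n,\\ y_1^{m_1}\cdots y_{2n}^{m_{2n}}\,(1+y_0)^{n+2},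 & k=n+1.\end{cases}$$ In particular, if $y_0\neq -1$ and $y_i\neq 0$ for all $i$, then $F_{j,k}\neq 0$ at $(y_i)$. -/

import Mathlib

namespace Pentagram

/-- The arithmetic progression `[a,b]_d = {a, a+d, a+2d, …, b}`; it is empty when `b < a`. -/
def arithProg (a b d : ℤ) : Set ℤ := {i | a ≤ i ∧ i ≤ b ∧ i ≡ a [ZMOD d]}

/-- Polynomials with integer coefficients in the variables `y_i`, `i ∈ ℤ`. -/
abbrev YPoly : Type := MvPolynomial ℤ ℤ

/-- The field of rational functions in the variables `y_i`, `i ∈ ℤ`. -/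
abbrev YRat : Type := FractionRing YPoly

noncomputable section

/-- The monomial `M_{j,k} = ∏_{i=-k}^{k} y_{3i+j}`. -/
def M (j : ℤ) (k : ℕ) : YPoly :=
  ∏ i ∈ Finset.Icc (-(k : ℤ)) (k : ℤ), MvPolynomial.X (3 * i + j)

/-- The `F`-polynomials with the second index shifted by one: `Fshift m j` is `F_{j,m-1}`.
Thus `F_{j,-1} = F_{j,0} = 1` and
`F_{j,k+1} = (F_{j-3,k} F_{j+3,k} + M_{j,k} F_{j-1,k} F_{j+1,k}) / F_{j,k-1}` for `k ≥ 0`,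
where the division is that of the field of rational functions. -/
def Fshift : ℕ → ℤ → YRat
  | 0, _ => 1
  | 1, _ => 1
  | k + 2, j =>
      (Fshift (k + 1) (j - 3) * Fshift (k + 1) (j + 3)
        + algebraMap YPoly YRat (M j k) * Fshift (k + 1) (j - 1) * Fshift (k + 1) (j + 1))
      / Fshift k j

/-- `F_{j,k}` for `k ≥ 0`, as an element of the field of rational functions. -/
def F (j : ℤ) (k : ℕ) : YRat := Fshift (k + 1) j

end

end Pentagram

/-!
The mutation of `Y`-variables that realizes one step of the pentagram map changes `F_{j,k}` only by
an explicit product of factors `1 + y_i`. The generating function of pairs of interlacing height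
functions transforms in the same way, site by site, so it equals `F_{j,k}`. Height functions are
alternating sign matrices in disguise; hence `F_{j,k}` is a sum over the matrices of size `k`, in
which an entry `1` at a site with variable `y_i` contributes `1 + y_i` and all other factors are
monomials.

In the special family, the variable at a site is `y_0` on a doubly periodic set of sites that meets
every row and every column once in each period `n`, and `-1` elsewhere. Only the matrices with all
their entries `1` in this set survive. For `k = n` there is one, a permutation matrix. For
`k = n + 1` there are two cases. If the set avoids the corners of the square, one matrix survives,
with `n + 2` entries `1` and one entry `-1`. Otherwise the set contains all four corners and two
permutation matrices survive, one for each pair of opposite corners; their monomials differ by the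
factor `y_0`, and adding them produces one more factor `1 + y_0`.
-/

namespace Pentagram

open Finset

/-! ### Mutation of the recursion -/

/-- The `k` integers `-(k - 1), -(k - 3), …, k - 1`, along which the `F`-polynomials are indexed. -/
def line (k : ℕ) : Finset ℤ := (range k).image fun i : ℕ => 2 * (i : ℤ) - ((k : ℤ) - 1)

lemma mem_line {k : ℕ} {x : ℤ} :
    x ∈ line k ↔ 1 - (k : ℤ) ≤ x ∧ x ≤ k - 1 ∧ (x + k - 1) % 2 = 0 := by
  simp only [line, mem_image, mem_range]
  constructor
  · rintro ⟨i, hi, rfl⟩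
    omega
  · rintro ⟨hl, hu, hpar⟩
    exact ⟨((x + k - 1) / 2).toNat, by omega, by omega⟩

section LineProd

variable {R : Type*} [CommMonoid R]

lemma prod_line (f : ℤ → R) (k : ℕ) :
    ∏ x ∈ line k, f x = ∏ i ∈ range k, f (2 * (i : ℤ) - ((k : ℤ) - 1)) := by
  rw [line, prod_image]
  intro a _ b _ h
  simpa using h

/-- The product of `g i` over the `k` indices `i = j - 3 (k - 1), j - 3 (k - 3), …, j + 3 (k - 1)`;
the monomial `M_{j,k}` is the product of two consecutive ones. -/
def lineProd (g : ℤ → R) (k : ℕ) (j : ℤ) : R := ∏ x ∈ line k, g (j + 3 * x)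

@[simp] lemma lineProd_zero (g : ℤ → R) (j : ℤ) : lineProd g 0 j = 1 := by
  simp [lineProd, line]

@[simp] lemma lineProd_one (g : ℤ → R) (j : ℤ) : lineProd g 1 j = g j := by
  simp [lineProd, line]

lemma lineProd_mul (f g : ℤ → R) (k : ℕ) (j : ℤ) :
    lineProd (fun i => f i * g i) k j = lineProd f k j * lineProd g k j := prod_mul_distrib

lemma lineProd_shift (g : ℤ → R) (k : ℕ) (j d : ℤ) :
    lineProd (fun i => g (i + d)) k j = lineProd g k (j + d) :=
  prod_congr rfl fun x _ => congrArg g (by ring)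

lemma lineProd_condensation (g : ℤ → R) (k : ℕ) (j : ℤ) :
    lineProd g (k + 1) (j - 3) * lineProd g (k + 1) (j + 3) =
      lineProd g (k + 2) j * lineProd g k j := by
  have eq_prod_range : ∀ (m : ℕ) (l : ℤ), lineProd g m l =
      ∏ i ∈ range m, g (l + 3 * (2 * (i : ℤ) - ((m : ℤ) - 1))) :=
    fun m l => prod_line (fun x => g (l + 3 * x)) m
  set h : ℕ → R := fun i => g (j + 3 * (2 * (i : ℤ) - ((k : ℤ) + 1)))
  have left : lineProd g (k + 1) (j - 3) = ∏ i ∈ range (k + 1), h i := by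
    rw [eq_prod_range]
    exact prod_congr rfl fun i _ => congrArg g (by push_cast; ring)
  have right : lineProd g (k + 1) (j + 3) = ∏ i ∈ range (k + 1), h (i + 1) := by
    rw [eq_prod_range]
    exact prod_congr rfl fun i _ => congrArg g (by push_cast; ring)
  have outer : lineProd g (k + 2) j = ∏ i ∈ range (k + 2), h i := by
    rw [eq_prod_range]
    exact prod_congr rfl fun i _ => congrArg g (by push_cast; ring)
  have inner : lineProd g k j = ∏ i ∈ range k, h (i + 1) := by
    rw [eq_prod_range]
    exact prod_congr rfl fun i _ => congrArg g (by push_cast; ring)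
  rw [left, right, outer, inner, prod_range_succ h (k + 1), prod_range_succ (fun i => h (i + 1)) k,
    mul_assoc, mul_comm (h (k + 1))]

lemma prod_Icc_eq_lineProd (g : ℤ → R) (k : ℕ) (j : ℤ) :
    ∏ i ∈ Icc (-(k : ℤ)) k, g (3 * i + j) = lineProd g (k + 1) j * lineProd g k j := by
  unfold lineProd
  have disjoint : Disjoint (line (k + 1)) (line k) := by
    rw [disjoint_left]
    intro x
    simp only [mem_line]
    push_cast
    omega
  have union : Icc (-(k : ℤ)) k = line (k + 1) ∪ line k := by
    ext x
    simp only [mem_union, mem_line, mem_Icc]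
    push_cast
    omega
  rw [← prod_union disjoint, union]
  exact prod_congr rfl fun x _ => by rw [add_comm]

end LineProd

section Mutation

variable {K : Type*} [Field K]

/-- The recursion of the `F`-polynomials with values in a field: `FVal y m j` is the value of
`F_{j,m-1}` at `y` as long as no denominator vanishes. -/
noncomputable def FVal (y : ℤ → K) : ℕ → ℤ → K
  | 0, _ => 1
  | 1, _ => 1
  | k + 2, j =>
      (FVal y (k + 1) (j - 3) * FVal y (k + 1) (j + 3)
        + (∏ i ∈ Icc (-(k : ℤ)) k, y (3 * i + j)) * FVal y (k + 1) (j - 1) * FVal y (k + 1) (j + 1))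
      / FVal y k j

lemma FVal_add_two (y : ℤ → K) (k : ℕ) (j : ℤ) : FVal y (k + 2) j =
    (FVal y (k + 1) (j - 3) * FVal y (k + 1) (j + 3)
      + (∏ i ∈ Icc (-(k : ℤ)) k, y (3 * i + j)) * FVal y (k + 1) (j - 1) * FVal y (k + 1) (j + 1))
    / FVal y k j := rfl

/-- The simultaneous `Y`-mutation at all indices congruent to `c` modulo `2`: one time step of the
pentagram map in the `y`-coordinates. -/
noncomputable def mutate (c : ℤ) (y : ℤ → K) (i : ℤ) : K :=
  if (i - c) % 2 = 0 then (y i)⁻¹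
  else y i * ((y (i + -3) / (1 + y (i + -3))) * (y (i + 3) / (1 + y (i + 3))) *
    ((1 + y (i + -1)) * (1 + y (i + 1))))

lemma mutate_of_even {c i : ℤ} (y : ℤ → K) (h : (i - c) % 2 = 0) : mutate c y i = (y i)⁻¹ :=
  if_pos h

lemma mutate_of_odd {c i : ℤ} (y : ℤ → K) (h : (i - c) % 2 = 1) :
    mutate c y i = y i * ((y (i + -3) / (1 + y (i + -3))) * (y (i + 3) / (1 + y (i + 3))) *
      ((1 + y (i + -1)) * (1 + y (i + 1)))) :=
  if_neg (by omega)

lemma lineProd_mutate_of_even {c : ℤ} (y : ℤ → K) {k : ℕ} {j : ℤ} (h : (j + k + 1 - c) % 2 = 0) :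
    lineProd (mutate c y) k j = (lineProd y k j)⁻¹ := by
  unfold lineProd
  rw [← prod_inv_distrib]
  refine prod_congr rfl fun x hx => ?_
  rw [mem_line] at hx
  exact mutate_of_even y (by omega)

lemma lineProd_mutate_of_odd {c : ℤ} (y : ℤ → K) {k : ℕ} {j : ℤ} (h : (j + k - c) % 2 = 0) :
    lineProd (mutate c y) k j = lineProd y k j *
      ((lineProd y k (j - 3) / lineProd (fun i => 1 + y i) k (j - 3)) *
       (lineProd y k (j + 3) / lineProd (fun i => 1 + y i) k (j + 3)) *
       (lineProd (fun i => 1 + y i) k (j - 1) * lineProd (fun i => 1 + y i) k (j + 1))) := by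
  have termwise : lineProd (mutate c y) k j =
      lineProd (fun i => y i * ((y (i + -3) / (1 + y (i + -3))) *
        (y (i + 3) / (1 + y (i + 3))) * ((1 + y (i + -1)) * (1 + y (i + 1))))) k j := by
    refine prod_congr rfl fun x hx => ?_
    rw [mem_line] at hx
    exact mutate_of_odd y (by omega)
  have lineProd_div : ∀ l : ℤ, lineProd y k l / lineProd (fun i => 1 + y i) k l =
      lineProd (fun i => y i / (1 + y i)) k l := fun l => (prod_div_distrib ..).symm
  rw [termwise]
  simp only [lineProd_div, sub_eq_add_neg, lineProd_mul]
  rw [← lineProd_shift, ← lineProd_shift, ← lineProd_shift _ _ _ (-1), ← lineProd_shift _ _ _ 1]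

lemma lineProd_ne_zero {g : ℤ → K} (hg : ∀ i, g i ≠ 0) (k : ℕ) (j : ℤ) : lineProd g k j ≠ 0 :=
  prod_ne_zero_iff.2 fun _ _ => hg _

lemma lineProd_mutate_mul_lineProd_mutate {y : ℤ → K} (hy : ∀ i, y i ≠ 0)
    (hy1 : ∀ i, 1 + y i ≠ 0) {c : ℤ} {k : ℕ} {j : ℤ} (h : (j + k + 1 - c) % 2 = 0) :
    lineProd (fun i => 1 + y i) k j * lineProd (fun i => 1 + y i) (k + 2) j *
        (lineProd (mutate c y) (k + 1) j * lineProd (mutate c y) k j) =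
      lineProd y (k + 2) j * lineProd y (k + 1) j *
        (lineProd (fun i => 1 + y i) (k + 1) (j - 1) *
          lineProd (fun i => 1 + y i) (k + 1) (j + 1)) := by
  have inner_ne := lineProd_ne_zero hy k j
  have left_ne := lineProd_ne_zero hy1 (k + 1) (j - 3)
  have right_ne := lineProd_ne_zero hy1 (k + 1) (j + 3)
  rw [lineProd_mutate_of_even y h, lineProd_mutate_of_odd y (by push_cast; omega),
    mul_comm (lineProd (fun i => 1 + y i) k j), ← lineProd_condensation,
    eq_div_of_mul_eq inner_ne (lineProd_condensation y k j).symm]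
  field_simp

theorem FVal_succ_eq_mutate {y : ℤ → K} (hy : ∀ i, y i ≠ 0) (hy1 : ∀ i, 1 + y i ≠ 0) (c : ℤ)
    (k : ℕ) : ∀ j : ℤ, (j + k + 1 - c) % 2 = 0 →
      FVal y (k + 1) j = lineProd (fun i => 1 + y i) k j * FVal (mutate c y) k j := by
  induction k using Nat.strong_induction_on with
  | _ k ih =>
    match k, ih with
    | 0, _ => simp [FVal]
    | 1, _ => simp [FVal]
    | k + 2, ih =>
      intro j hj
      push_cast at hj
      have ih1 := ih (k + 1) (by omega)
      have ih0 := ih k (by omega) j (by omega)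
      have coeff := lineProd_mutate_mul_lineProd_mutate hy hy1 (c := c) (k := k) (j := j) (by omega)
      rw [FVal_add_two, ih1 (j - 3) (by push_cast; omega), ih1 (j + 3) (by push_cast; omega),
        ih1 (j - 1) (by push_cast; omega), ih1 (j + 1) (by push_cast; omega), ih0, FVal_add_two,
        prod_Icc_eq_lineProd, prod_Icc_eq_lineProd, ← mul_div_assoc,
        ← mul_div_mul_left _ (FVal (mutate c y) k j) (lineProd_ne_zero hy1 k j)]
      congr 1
      linear_combination
        -(FVal (mutate c y) (k + 1) (j - 1) * FVal (mutate c y) (k + 1) (j + 1)) * coeff +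
        FVal (mutate c y) (k + 1) (j - 3) * FVal (mutate c y) (k + 1) (j + 3) *
          lineProd_condensation (fun i => 1 + y i) k j

end Mutation

/-! ### Interlacing height functions -/

/-- The square array of `k × k` sites: pairs of indices in `line k`. -/
def sites (k : ℕ) : Finset (ℤ × ℤ) := line k ×ˢ line k

/-- The site with matrix coordinates `(u, v)`, `0 ≤ u, v < k`, in the array of size `k`. -/
def cell (k u v : ℕ) : ℤ × ℤ := (2 * (u : ℤ) - ((k : ℤ) - 1), 2 * (v : ℤ) - ((k : ℤ) - 1))

/-- The point with coordinates `(u, v)`, `0 ≤ u, v ≤ k`, of the grid of corners of the sites of the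
array of size `k`; the inner ones are the sites of the array of size `k - 1`. -/
def vertex (k u v : ℕ) : ℤ × ℤ := (2 * (u : ℤ) - k, 2 * (v : ℤ) - k)

lemma mem_sites {k : ℕ} {p : ℤ × ℤ} :
    p ∈ sites k ↔ (1 - (k : ℤ) ≤ p.1 ∧ p.1 ≤ k - 1 ∧ (p.1 + k - 1) % 2 = 0) ∧
      (1 - (k : ℤ) ≤ p.2 ∧ p.2 ≤ k - 1 ∧ (p.2 + k - 1) % 2 = 0) := by
  rw [sites, mem_product, mem_line, mem_line]

@[simp] lemma sites_zero : sites 0 = ∅ := by simp [sites, line]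

lemma parity_of_mem_sites {k : ℕ} {p : ℤ × ℤ} (hp : p ∈ sites k) : (p.1 + p.2) % 2 = 0 := by
  rw [mem_sites] at hp
  omega

lemma sites_sub_one_subset (m : ℕ) : sites (m - 1) ⊆ sites (m + 1) := by
  intro p hp
  rw [mem_sites] at hp ⊢
  push_cast
  omega

lemma mem_sites_sub_one {m : ℕ} {p : ℤ × ℤ} (hne : (p.1 + 1, p.2 + 1) ∈ sites m)
    (hsw : (p.1 + -1, p.2 + -1) ∈ sites m) : p ∈ sites (m - 1) := by
  rw [mem_sites] at *
  simp only at hne hsw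
  omega

lemma cell_parity (k u v : ℕ) : ((cell k u v).1 + (cell k u v).2) % 2 = 0 := by
  simp only [cell]
  omega

lemma exists_eq_cell {k : ℕ} {p : ℤ × ℤ} (hp : p ∈ sites k) :
    ∃ u < k, ∃ v < k, p = cell k u v := by
  rw [mem_sites] at hp
  refine ⟨((p.1 + k - 1) / 2).toNat, by omega, ((p.2 + k - 1) / 2).toNat, by omega, ?_⟩
  ext <;> simp only [cell] <;> omega

lemma vertex_mem_sites {k u v : ℕ} :
    vertex k u v ∈ sites (k - 1) ↔ (0 < u ∧ u < k) ∧ 0 < v ∧ v < k := by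
  rw [mem_sites, vertex]
  omega

lemma exists_eq_vertex {k : ℕ} {q : ℤ × ℤ} (hq : q ∈ sites (k - 1)) :
    ∃ u ≤ k, ∃ v ≤ k, q = vertex k u v := by
  rw [mem_sites] at hq
  refine ⟨((q.1 + k) / 2).toNat, by omega, ((q.2 + k) / 2).toNat, by omega, ?_⟩
  ext <;> simp only [vertex] <;> omega

lemma prod_sites {R : Type*} [CommMonoid R] (f : ℤ × ℤ → R) (k : ℕ) :
    ∏ p ∈ sites k, f p = ∏ u ∈ range k, ∏ v ∈ range k, f (cell k u v) := by
  simp only [sites, prod_product, prod_line, cell]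

/-- Integer heights with finite support on the points of the plane. The sites of two consecutive
square arrays interlace, and only the values at points `p` with `p.1 + p.2` even matter. -/
abbrev HeightFunction : Type := ℤ × ℤ →₀ ℤ

namespace HeightFunction

section Neighbours

variable (b : HeightFunction) (p : ℤ × ℤ)

/-- The height at the neighbour `p + (1, 1)`. -/
def east : ℤ := b (p.1 + 1, p.2 + 1)

/-- The height at the neighbour `p + (-1, -1)`. -/
def west : ℤ := b (p.1 + -1, p.2 + -1)

/-- The height at the neighbour `p + (1, -1)`, lowered by one strictly above the diagonal so that
the compatibility conditions below are the same at all points. -/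
def north : ℤ := b (p.1 + 1, p.2 + -1) - if p.2 ≤ p.1 then 0 else 1

/-- The height at the neighbour `p + (-1, 1)`, lowered by one strictly below the diagonal. -/
def south : ℤ := b (p.1 + -1, p.2 + 1) - if p.1 ≤ p.2 then 0 else 1

/-- The heights at `p` that may follow in the next layer the heights `b` at the neighbours
of `p`. -/
noncomputable def nextRange : Finset ℤ :=
  Icc (max (max (b.east p) (b.west p)) (max (b.north p) (b.south p)))
    (min (min (b.east p) (b.west p)) (min (b.north p) (b.south p)) + 1)

/-- The heights at `p` that may precede in the previous layer the heights `b` at the neighbours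
of `p`. -/
noncomputable def prevRange : Finset ℤ :=
  Icc (max (max (b.east p - 1) (b.west p - 1)) (max (b.north p) (b.south p)))
    (min (min (b.east p) (b.west p)) (min (b.north p + 1) (b.south p + 1)))

/-- The heights `b` are compatible with some layer of heights on the interlacing points. -/
def Admissible : Prop := ∀ p : ℤ × ℤ, (p.1 + p.2) % 2 = 0 →
  (b.north p ≤ b.east p ∧ b.east p ≤ b.north p + 1) ∧
  (b.north p ≤ b.west p ∧ b.west p ≤ b.north p + 1) ∧
  (b.south p ≤ b.east p ∧ b.east p ≤ b.south p + 1) ∧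
  (b.south p ≤ b.west p ∧ b.west p ≤ b.south p + 1)

end Neighbours

section Interlacing

variable {a b : HeightFunction} {p : ℤ × ℤ}

lemma mem_nextRange {x : ℤ} : x ∈ b.nextRange p ↔
    (b.east p ≤ x ∧ x ≤ b.east p + 1) ∧ (b.west p ≤ x ∧ x ≤ b.west p + 1) ∧
    (b.north p ≤ x ∧ x ≤ b.north p + 1) ∧ (b.south p ≤ x ∧ x ≤ b.south p + 1) := by
  rw [nextRange, mem_Icc]
  omega

lemma mem_prevRange {x : ℤ} : x ∈ b.prevRange p ↔
    (b.east p - 1 ≤ x ∧ x ≤ b.east p) ∧ (b.west p - 1 ≤ x ∧ x ≤ b.west p) ∧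
    (b.north p ≤ x ∧ x ≤ b.north p + 1) ∧ (b.south p ≤ x ∧ x ≤ b.south p + 1) := by
  rw [prevRange, mem_Icc]
  omega

lemma forall_mem_nextRange_iff_forall_mem_prevRange :
    (∀ q : ℤ × ℤ, (q.1 + q.2) % 2 = 0 → b q ∈ a.nextRange q) ↔
      ∀ p : ℤ × ℤ, (p.1 + p.2) % 2 = 0 → a p ∈ b.prevRange p := by
  simp only [mem_nextRange, mem_prevRange, east, west, north, south]
  constructor
  all_goals
    rintro h ⟨x, z⟩ hp
    simp only at hp
    have hne := (h (x + 1, z + 1) (by simp only; omega)).2.1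
    have hsw := (h (x + -1, z + -1) (by simp only; omega)).1
    have hse := (h (x + 1, z + -1) (by simp only; omega)).2.2.2
    have hnw := (h (x + -1, z + 1) (by simp only; omega)).2.2.1
    simp only [add_neg_cancel_right, neg_add_cancel_right] at hne hsw hse hnw ⊢
    clear h
    omega

lemma admissible_of_nextRange_nonempty
    (h : ∀ p : ℤ × ℤ, (p.1 + p.2) % 2 = 0 → (b.nextRange p).Nonempty) : b.Admissible := by
  rintro ⟨x, z⟩ hp
  simp only at hp
  obtain ⟨_, h0⟩ := h (x, z) hp
  obtain ⟨_, h1⟩ := h (x + 1 + 1, z) (by simp only; omega)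
  obtain ⟨_, h2⟩ := h (x + -1 + -1, z) (by simp only; omega)
  obtain ⟨_, h3⟩ := h (x, z + 1 + 1) (by simp only; omega)
  obtain ⟨_, h4⟩ := h (x, z + -1 + -1) (by simp only; omega)
  clear h
  simp only [mem_nextRange, east, west, north, south, add_neg_cancel_right,
    neg_add_cancel_right] at *
  omega

lemma admissible_of_prevRange_nonempty
    (h : ∀ p : ℤ × ℤ, (p.1 + p.2) % 2 = 0 → (b.prevRange p).Nonempty) : b.Admissible := by
  rintro ⟨x, z⟩ hp
  simp only at hp
  obtain ⟨_, h0⟩ := h (x, z) hp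
  obtain ⟨_, h1⟩ := h (x + 1 + 1, z) (by simp only; omega)
  obtain ⟨_, h2⟩ := h (x + -1 + -1, z) (by simp only; omega)
  obtain ⟨_, h3⟩ := h (x, z + 1 + 1) (by simp only; omega)
  obtain ⟨_, h4⟩ := h (x, z + -1 + -1) (by simp only; omega)
  clear h
  simp only [mem_prevRange, east, west, north, south, add_neg_cancel_right,
    neg_add_cancel_right] at *
  omega

lemma eq_zero_of_notMem {k : ℕ} (h : b.support ⊆ sites k) (hp : p ∉ sites k) : b p = 0 :=
  Finsupp.notMem_support_iff.1 fun hmem => hp (h hmem)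

lemma neighbours_eq_zero {k : ℕ} (h : b.support ⊆ sites (k - 1)) (hp : p ∉ sites k) :
    b (p.1 + 1, p.2 + 1) = 0 ∧ b (p.1 + -1, p.2 + -1) = 0 ∧
      b (p.1 + 1, p.2 + -1) = 0 ∧ b (p.1 + -1, p.2 + 1) = 0 := by
  refine ⟨?_, ?_, ?_, ?_⟩
  all_goals
    refine eq_zero_of_notMem h fun hq => hp ?_
    rw [mem_sites] at hq ⊢
    simp only at hq
    omega

lemma mem_nextRange_of_notMem {k : ℕ} (h : b.support ⊆ sites (k - 1)) (hp : p ∉ sites k) :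
    (0 : ℤ) ∈ b.nextRange p := by
  obtain ⟨heast, hwest, hnorth, hsouth⟩ := neighbours_eq_zero h hp
  rw [mem_nextRange, east, west, north, south, heast, hwest, hnorth, hsouth]
  omega

lemma mem_prevRange_of_notMem {k : ℕ} (h : b.support ⊆ sites (k - 1)) (hp : p ∉ sites k) :
    (0 : ℤ) ∈ b.prevRange p := by
  obtain ⟨heast, hwest, hnorth, hsouth⟩ := neighbours_eq_zero h hp
  rw [mem_prevRange, east, west, north, south, heast, hwest, hnorth, hsouth]
  omega

end Interlacing

section Corner

variable (b : HeightFunction) (k u v : ℕ)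

/-- The height of `b` at a vertex of the array of size `k`, measured down from `min u v`; for the
height function of a matrix this is the sum of the `u × v` submatrix at the corner. -/
def corner : ℤ := min (u : ℤ) v - b (vertex k u v)

lemma east_cell : b.east (cell k u v) = min (u : ℤ) v + 1 - b.corner k (u + 1) (v + 1) := by
  have : ((cell k u v).1 + 1, (cell k u v).2 + 1) = vertex k (u + 1) (v + 1) := by
    ext <;> simp only [cell, vertex] <;> push_cast <;> ring
  rw [east, corner, this]
  omega

lemma west_cell : b.west (cell k u v) = min (u : ℤ) v - b.corner k u v := by
  have : ((cell k u v).1 + -1, (cell k u v).2 + -1) = vertex k u v := by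
    ext <;> simp only [cell, vertex] <;> ring
  rw [west, corner, this]
  omega

lemma north_cell : b.north (cell k u v) = min (u : ℤ) v - b.corner k (u + 1) v := by
  have : ((cell k u v).1 + 1, (cell k u v).2 + -1) = vertex k (u + 1) v := by
    ext <;> simp only [cell, vertex] <;> push_cast <;> ring
  rw [north, corner, this]
  simp only [cell]
  omega

lemma south_cell : b.south (cell k u v) = min (u : ℤ) v - b.corner k u (v + 1) := by
  have : ((cell k u v).1 + -1, (cell k u v).2 + 1) = vertex k u (v + 1) := by
    ext <;> simp only [cell, vertex] <;> push_cast <;> ring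
  rw [south, corner, this]
  simp only [cell]
  omega

variable {b k u v}

lemma corner_boundary (hb : b.support ⊆ sites (k - 1))
    (h : u = 0 ∨ v = 0 ∨ u = k ∨ v = k) : b.corner k u v = min (u : ℤ) v := by
  rw [corner, eq_zero_of_notMem hb, sub_zero]
  rw [vertex_mem_sites]
  omega

lemma Admissible.corner_succ_left (hb : b.Admissible) (k u v : ℕ) :
    b.corner k u v ≤ b.corner k (u + 1) v ∧ b.corner k (u + 1) v ≤ b.corner k u v + 1 := by
  have := hb _ (cell_parity k u v)
  rw [east_cell, west_cell, north_cell, south_cell] at this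
  omega

lemma Admissible.corner_succ_right (hb : b.Admissible) (k u v : ℕ) :
    b.corner k u v ≤ b.corner k u (v + 1) ∧ b.corner k u (v + 1) ≤ b.corner k u v + 1 := by
  have := hb _ (cell_parity k u v)
  rw [east_cell, west_cell, north_cell, south_cell] at this
  omega

lemma Admissible.corner_mem_Icc (hb : b.Admissible) (hs : b.support ⊆ sites (k - 1)) :
    b.corner k u v ∈ Set.Icc (0 : ℤ) (min u v) := by
  have left : 0 ≤ b.corner k u v ∧ b.corner k u v ≤ u := by
    induction u with
    | zero => simp [corner_boundary hs]
    | succ u ih =>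
      have := hb.corner_succ_left k u v
      push_cast
      omega
  have right : b.corner k u v ≤ v := by
    clear left
    induction v with
    | zero => simp [corner_boundary hs]
    | succ v ih =>
      have := hb.corner_succ_right k u v
      push_cast
      omega
  exact ⟨left.1, le_min left.2 right⟩

lemma Admissible.mem_Icc (hb : b.Admissible) (hs : b.support ⊆ sites (k - 1)) (q : ℤ × ℤ) :
    b q ∈ Set.Icc (0 : ℤ) k := by
  by_cases hq : q ∈ sites (k - 1)
  · obtain ⟨u, _, v, _, rfl⟩ := exists_eq_vertex hq
    have hc := hb.corner_mem_Icc (u := u) (v := v) hs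
    rw [corner, Set.mem_Icc] at hc
    rw [Set.mem_Icc]
    omega
  · simp [eq_zero_of_notMem hs hq]

end Corner

open Classical in
/-- The admissible height functions on the array of size `k - 1`. -/
noncomputable def heights (k : ℕ) : Finset HeightFunction :=
  {b ∈ (sites (k - 1)).finsupp fun _ => Icc (0 : ℤ) k | Admissible b}

lemma mem_heights {b : HeightFunction} {k : ℕ} :
    b ∈ heights k ↔ b.support ⊆ sites (k - 1) ∧ b.Admissible := by
  simp only [heights, mem_filter, mem_finsupp_iff, and_assoc]
  refine and_congr_right fun hs => and_iff_right_of_imp fun hb q _ => ?_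
  simpa using hb.mem_Icc hs q

lemma nonneg_of_mem_heights {b : HeightFunction} {k : ℕ} (hb : b ∈ heights k) (q : ℤ × ℤ) :
    0 ≤ b q :=
  ((mem_heights.1 hb).2.mem_Icc (mem_heights.1 hb).1 q).1

lemma heights_zero : heights 0 = {0} := by
  ext b
  rw [mem_heights, mem_singleton]
  constructor
  · rintro ⟨hs, -⟩
    simpa using hs
  · rintro rfl
    refine ⟨by simp, fun p _ => ?_⟩
    simp only [east, west, north, south, Finsupp.coe_zero, Pi.zero_apply]
    omega

lemma forall_mem_nextRange {a b : HeightFunction} {k : ℕ} (ha : a.support ⊆ sites (k - 1))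
    (hb : b ∈ (sites k).finsupp a.nextRange) (q : ℤ × ℤ) : b q ∈ a.nextRange q := by
  rw [mem_finsupp_iff] at hb
  by_cases hq : q ∈ sites k
  · exact hb.2 q hq
  · rw [eq_zero_of_notMem hb.1 hq]
    exact mem_nextRange_of_notMem ha hq

lemma forall_mem_prevRange {a b : HeightFunction} {k : ℕ} (hb : b.support ⊆ sites (k - 1))
    (ha : a ∈ (sites k).finsupp b.prevRange) (p : ℤ × ℤ) : a p ∈ b.prevRange p := by
  rw [mem_finsupp_iff] at ha
  by_cases hp : p ∈ sites k
  · exact ha.2 p hp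
  · rw [eq_zero_of_notMem ha.1 hp]
    exact mem_prevRange_of_notMem hb hp

lemma support_subset_of_forall_mem_prevRange {a b : HeightFunction} {m : ℕ}
    (hb : b ∈ heights (m + 1)) (ha : ∀ p, a p ∈ b.prevRange p) : a.support ⊆ sites (m - 1) := by
  intro p hp
  rw [Finsupp.mem_support_iff] at hp
  have range := mem_prevRange.1 (ha p)
  have nonneg := nonneg_of_mem_heights hb
  have nonneg_north := nonneg (p.1 + 1, p.2 + -1)
  have nonneg_south := nonneg (p.1 + -1, p.2 + 1)
  simp only [east, west, north, south] at range
  have mem_of_ne_zero : ∀ {q}, b q ≠ 0 → q ∈ sites m :=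
    fun hq => (mem_heights.1 hb).1 (Finsupp.mem_support_iff.2 hq)
  exact mem_sites_sub_one (mem_of_ne_zero (by omega)) (mem_of_ne_zero (by omega))

lemma mem_heights_and_mem_finsupp_iff {a b : HeightFunction} {m : ℕ} :
    a ∈ heights m ∧ b ∈ (sites m).finsupp a.nextRange ↔
      a ∈ (sites (m + 1)).finsupp b.prevRange ∧ b ∈ heights (m + 1) := by
  constructor
  · rintro ⟨ha, hb⟩
    have ha_sub := (mem_heights.1 ha).1
    have ha_mem : ∀ p : ℤ × ℤ, (p.1 + p.2) % 2 = 0 → a p ∈ b.prevRange p :=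
      forall_mem_nextRange_iff_forall_mem_prevRange.1 fun q _ => forall_mem_nextRange ha_sub hb q
    exact ⟨mem_finsupp_iff.2 ⟨ha_sub.trans (sites_sub_one_subset m),
        fun p hp => ha_mem p (parity_of_mem_sites hp)⟩,
      mem_heights.2 ⟨(mem_finsupp_iff.1 hb).1,
        admissible_of_prevRange_nonempty fun p hp => ⟨_, ha_mem p hp⟩⟩⟩
  · rintro ⟨ha, hb⟩
    have hb_sub := (mem_heights.1 hb).1
    have ha_mem := forall_mem_prevRange hb_sub ha
    have hb_mem : ∀ q : ℤ × ℤ, (q.1 + q.2) % 2 = 0 → b q ∈ a.nextRange q :=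
      forall_mem_nextRange_iff_forall_mem_prevRange.2 fun p _ => ha_mem p
    exact ⟨mem_heights.2 ⟨support_subset_of_forall_mem_prevRange hb ha_mem,
        admissible_of_nextRange_nonempty fun q hq => ⟨_, hb_mem q hq⟩⟩,
      mem_finsupp_iff.2 ⟨hb_sub, fun q hq => hb_mem q (parity_of_mem_sites hq)⟩⟩

end HeightFunction

/-! ### The generating function of interlacing pairs -/

lemma prod_sum_eq_sum_finsupp {ι α R : Type*} [Zero α] [CommSemiring R]
    (s : Finset ι) (t : ι → Finset α) (f : ι → α → R) :
    ∏ p ∈ s, ∑ x ∈ t p, f p x = ∑ h ∈ s.finsupp t, ∏ p ∈ s, f p (h p) := by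
  classical
  rw [prod_sum, Finset.finsupp, sum_map]
  refine sum_congr rfl fun g _ => ?_
  rw [← prod_attach s]
  refine prod_congr rfl fun p _ => ?_
  simp [Finsupp.indicator_of_mem p.2]

namespace HeightFunction

section LocalIdentity

variable {b : HeightFunction} {p : ℤ × ℤ}

/-- The mixed difference of `b` around `p`; over the sites of a square array these are the entries
of an alternating sign matrix. -/
def entry (b : HeightFunction) (p : ℤ × ℤ) : ℤ :=
  1 + b.north p + b.south p - b.east p - b.west p

lemma Admissible.nextRange_eq (hb : b.Admissible) (hp : (p.1 + p.2) % 2 = 0) :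
    b.nextRange p = if b.entry p = 1 then {max (b.east p) (b.west p), max (b.east p) (b.west p) + 1}
      else {max (b.east p) (b.west p)} := by
  have := hb p hp
  ext x
  rw [mem_nextRange, entry]
  split_ifs
  all_goals
    simp only [mem_insert, mem_singleton]
    omega

lemma Admissible.prevRange_eq (hb : b.Admissible) (hp : (p.1 + p.2) % 2 = 0) :
    b.prevRange p = if b.entry p = -1 then
        {max (b.north p) (b.south p), max (b.north p) (b.south p) + 1}
      else {max (b.north p) (b.south p)} := by
  have := hb p hp
  ext x
  rw [mem_prevRange, entry]
  split_ifs
  all_goals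
    simp only [mem_insert, mem_singleton]
    omega

lemma Admissible.entry_eq (hb : b.Admissible) (hp : (p.1 + p.2) % 2 = 0) :
    b.entry p = -1 ∨ b.entry p = 0 ∨ b.entry p = 1 := by
  have := hb p hp
  rw [entry]
  omega

lemma Admissible.east_add_west (hb : b.Admissible) (hp : (p.1 + p.2) % 2 = 0) :
    b.east p + b.west p = max (b.east p) (b.west p) + max (b.north p) (b.south p) +
      if b.entry p = -1 then 1 else 0 := by
  have := hb p hp
  rw [entry]
  split_ifs <;> omega

lemma Admissible.sum_zpow_nextRange {K : Type*} [Field K] {y : K} (hy : y ≠ 0) (hy1 : 1 + y ≠ 0)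
    (hb : b.Admissible) (hp : (p.1 + p.2) % 2 = 0) :
    ∑ x ∈ b.nextRange p, y ^ x =
      (y / (1 + y)) ^ (b.east p + b.west p) * (1 + y) ^ (1 + b.north p + b.south p) *
        ∑ x ∈ b.prevRange p, y⁻¹ ^ x := by
  have exponents : (y / (1 + y)) ^ (b.east p + b.west p) * (1 + y) ^ (1 + b.north p + b.south p) =
      y ^ (b.east p + b.west p) * (1 + y) ^ b.entry p := by
    rw [div_zpow, div_mul_eq_mul_div, mul_div_assoc, ← zpow_sub₀ hy1, entry, sub_sub]
  rw [exponents, hb.east_add_west hp, hb.nextRange_eq hp, hb.prevRange_eq hp]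
  generalize max (b.east p) (b.west p) = l
  generalize max (b.north p) (b.south p) = r
  rcases hb.entry_eq hp with h | h | h
  · simp only [h, Int.reduceNeg, reduceCtorEq, reduceIte, sum_singleton, zpow_add₀ hy, zpow_one,
      zpow_neg, inv_zpow', mem_singleton, left_eq_add, one_ne_zero, not_false_eq_true, sum_insert,
      mul_inv_rev]
    field_simp
    ring
  · simp only [h, zero_ne_one, reduceIte, sum_singleton, Int.reduceNeg, zero_eq_neg, one_ne_zero,
      add_zero, zpow_add₀ hy, zpow_zero, mul_one, inv_zpow', zpow_neg]
    field_simp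
  · simp only [h, reduceIte, mem_singleton, left_eq_add, one_ne_zero, not_false_eq_true,
      sum_insert, sum_singleton, zpow_add₀ hy, zpow_one, Int.reduceNeg, reduceCtorEq, add_zero,
      inv_zpow', zpow_neg]
    field_simp

end LocalIdentity

end HeightFunction

/-- The index of the variable attached to a site, for the array centred at index `j`. -/
def idx (j : ℤ) (p : ℤ × ℤ) : ℤ := j + 2 * p.1 + p.2

section PartitionSum

open HeightFunction

variable {K : Type*} [Field K]

/-- The generating function of the pairs of consecutive interlacing height functions on the arrays
of sizes `k - 1` and `k`, each height at a site contributing a power of the variable there. -/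
noncomputable def partitionSum (y : ℤ → K) (j : ℤ) (k : ℕ) : K :=
  ∑ b ∈ heights k, (∏ q ∈ sites (k - 1), y (idx j q) ^ b q) *
    ∏ p ∈ sites k, ∑ x ∈ b.nextRange p, y (idx j p) ^ x

@[simp] lemma partitionSum_zero (y : ℤ → K) (j : ℤ) : partitionSum y j 0 = 1 := by
  simp [partitionSum, heights_zero]

lemma lineProd_eq_prod_sites (g : ℤ → K) (k : ℕ) (j : ℤ) :
    lineProd g k j = ∏ p ∈ sites k, if p.1 = p.2 then g (idx j p) else 1 := by
  rw [sites, prod_product, lineProd]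
  refine prod_congr rfl fun x hx => ?_
  rw [prod_ite_eq, if_pos hx, idx]
  congr 1
  ring

lemma prod_sites_shift {k : ℕ} {b : HeightFunction} (hb : b.support ⊆ sites k) (f : ℤ × ℤ → K)
    {d₁ d₂ : ℤ} (h₁ : d₁ = 1 ∨ d₁ = -1) (h₂ : d₂ = 1 ∨ d₂ = -1) :
    ∏ q ∈ sites k, f (q.1 + d₁, q.2 + d₂) ^ b q =
      ∏ p ∈ sites (k + 1), f p ^ b (p.1 + -d₁, p.2 + -d₂) := by
  refine prod_of_injOn (fun q => (q.1 + d₁, q.2 + d₂)) ?_ ?_ ?_ ?_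
  · rintro ⟨x, z⟩ _ ⟨x', z'⟩ _ h
    simpa using h
  · intro q hq
    simp only [mem_coe, mem_sites] at hq ⊢
    push_cast
    omega
  · intro p _ hp
    rw [eq_zero_of_notMem hb, zpow_zero]
    exact fun hq => hp ⟨_, hq, by simp⟩
  · simp

lemma prod_mutate_zpow {m : ℕ} {b : HeightFunction} (hb : b.support ⊆ sites m) (y : ℤ → K)
    {c j : ℤ} (hc : (j + m - c) % 2 = 0) :
    ∏ q ∈ sites m, mutate c y (idx j q) ^ b q = (∏ q ∈ sites m, y (idx j q) ^ b q) *
      ∏ p ∈ sites (m + 1), (((y (idx j p) / (1 + y (idx j p))) ^ b.east p *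
        (y (idx j p) / (1 + y (idx j p))) ^ b.west p) *
        ((1 + y (idx j p)) ^ b (p.1 + 1, p.2 + -1) *
          (1 + y (idx j p)) ^ b (p.1 + -1, p.2 + 1))) := by
  have shift_east := prod_sites_shift hb (fun p => y (idx j p) / (1 + y (idx j p)))
    (d₁ := -1) (d₂ := -1) (by simp) (by simp)
  have shift_west := prod_sites_shift hb (fun p => y (idx j p) / (1 + y (idx j p)))
    (d₁ := 1) (d₂ := 1) (by simp) (by simp)
  have shift_north := prod_sites_shift hb (fun p => 1 + y (idx j p))
    (d₁ := -1) (d₂ := 1) (by simp) (by simp)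
  have shift_south := prod_sites_shift hb (fun p => 1 + y (idx j p))
    (d₁ := 1) (d₂ := -1) (by simp) (by simp)
  simp only [neg_neg] at shift_east shift_west shift_north shift_south
  simp only [prod_mul_distrib, east, west]
  rw [← shift_east, ← shift_west, ← shift_north, ← shift_south]
  simp only [← prod_mul_distrib]
  refine prod_congr rfl fun q hq => ?_
  rw [mem_sites] at hq
  rw [mutate_of_odd y (by simp only [idx]; omega),
    show idx j (q.1 + 1, q.2 + 1) = idx j q + 3 by simp only [idx]; ring,
    show idx j (q.1 + -1, q.2 + -1) = idx j q + -3 by simp only [idx]; ring,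
    show idx j (q.1 + 1, q.2 + -1) = idx j q + 1 by simp only [idx]; ring,
    show idx j (q.1 + -1, q.2 + 1) = idx j q + -1 by simp only [idx]; ring]
  simp only [mul_zpow]

lemma one_add_zpow_north_south {y : K} (hy1 : 1 + y ≠ 0) (b : HeightFunction) (p : ℤ × ℤ) :
    (1 + y) ^ (1 + b.north p + b.south p) = (if p.1 = p.2 then 1 + y else 1) *
      ((1 + y) ^ b (p.1 + 1, p.2 + -1) * (1 + y) ^ b (p.1 + -1, p.2 + 1)) := by
  have exponent : 1 + b.north p + b.south p =
      (if p.1 = p.2 then 1 else 0) + (b (p.1 + 1, p.2 + -1) + b (p.1 + -1, p.2 + 1)) := by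
    simp only [north, south]
    omega
  rw [exponent, zpow_add₀ hy1, zpow_add₀ hy1]
  split_ifs <;> simp

lemma prod_sum_zpow_nextRange {m : ℕ} {b : HeightFunction} (hb : b ∈ heights (m + 1)) {y : ℤ → K}
    (hy : ∀ i, y i ≠ 0) (hy1 : ∀ i, 1 + y i ≠ 0) {c j : ℤ} (hc : (j + m - c) % 2 = 0) :
    (∏ q ∈ sites m, y (idx j q) ^ b q) *
        ∏ p ∈ sites (m + 1), ∑ x ∈ b.nextRange p, y (idx j p) ^ x =
      lineProd (fun i => 1 + y i) (m + 1) j * ((∏ q ∈ sites m, mutate c y (idx j q) ^ b q) *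
        ∏ p ∈ sites (m + 1), ∑ x ∈ b.prevRange p, (y (idx j p))⁻¹ ^ x) := by
  obtain ⟨hb_sub, hb_adm⟩ := mem_heights.1 hb
  rw [prod_mutate_zpow (m := m) hb_sub y hc, lineProd_eq_prod_sites, mul_assoc, mul_left_comm,
    ← prod_mul_distrib, ← prod_mul_distrib]
  congr 1
  refine prod_congr rfl fun p hp => ?_
  rw [hb_adm.sum_zpow_nextRange (hy _) (hy1 _) (parity_of_mem_sites hp),
    one_add_zpow_north_south (hy1 _), zpow_add₀ (div_ne_zero (hy _) (hy1 _))]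
  ring

lemma partitionSum_mutate (y : ℤ → K) {m : ℕ} {c j : ℤ} (hc : (j + m - c) % 2 = 0) :
    partitionSum (mutate c y) j m =
      ∑ a ∈ heights m, ∑ b ∈ (sites m).finsupp a.nextRange,
        (∏ p ∈ sites (m + 1), (y (idx j p))⁻¹ ^ a p) *
          ∏ q ∈ sites m, mutate c y (idx j q) ^ b q := by
  refine sum_congr rfl fun a ha => ?_
  have extend : ∏ p ∈ sites (m - 1), mutate c y (idx j p) ^ a p =
      ∏ p ∈ sites (m + 1), (y (idx j p))⁻¹ ^ a p := by
    rw [← prod_subset (sites_sub_one_subset m)]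
    · refine prod_congr rfl fun p hp => ?_
      rw [mem_sites] at hp
      rw [mutate_of_even y (by simp only [idx]; omega)]
    · intro p _ hp
      rw [eq_zero_of_notMem (mem_heights.1 ha).1 hp, zpow_zero]
  rw [prod_sum_eq_sum_finsupp, mul_sum, extend]

theorem partitionSum_succ {y : ℤ → K} (hy : ∀ i, y i ≠ 0) (hy1 : ∀ i, 1 + y i ≠ 0) {m : ℕ}
    {c j : ℤ} (hc : (j + m - c) % 2 = 0) :
    partitionSum y j (m + 1) =
      lineProd (fun i => 1 + y i) (m + 1) j * partitionSum (mutate c y) j m := by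
  rw [partitionSum_mutate y hc, sum_comm' (t' := heights (m + 1))
    (s' := fun b => (sites (m + 1)).finsupp b.prevRange)
    (fun a b => mem_heights_and_mem_finsupp_iff), partitionSum, mul_sum]
  refine sum_congr rfl fun b hb => ?_
  rw [← sum_mul, ← prod_sum_eq_sum_finsupp (sites (m + 1)) b.prevRange
    (fun p x => (y (idx j p))⁻¹ ^ x), mul_comm _ (∏ q ∈ sites m, _)]
  exact prod_sum_zpow_nextRange hb hy hy1 hc

end PartitionSum

section Positivity

variable {K : Type*} [Field K] [LinearOrder K] [IsStrictOrderedRing K] {y : ℤ → K}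

lemma mutate_pos (hy : ∀ i, 0 < y i) (c i : ℤ) : 0 < mutate c y i := by
  have hy1 : ∀ l, 0 < 1 + y l := fun l => add_pos one_pos (hy l)
  have div_pos : ∀ l, 0 < y l / (1 + y l) := fun l => div_pos (hy l) (hy1 l)
  rw [mutate]
  split_ifs
  · exact inv_pos.2 (hy i)
  · exact mul_pos (hy i) (mul_pos (mul_pos (div_pos _) (div_pos _)) (mul_pos (hy1 _) (hy1 _)))

lemma FVal_pos (hy : ∀ i, 0 < y i) (k : ℕ) : ∀ j, 0 < FVal y k j := by
  induction k using Nat.strong_induction_on with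
  | _ k ih =>
    match k, ih with
    | 0, _ => simp [FVal]
    | 1, _ => simp [FVal]
    | k + 2, ih =>
      intro j
      have ih1 := ih (k + 1) (by omega)
      have ih0 := ih k (by omega) j
      have hM : 0 < ∏ i ∈ Icc (-(k : ℤ)) k, y (3 * i + j) := prod_pos fun i _ => hy _
      rw [FVal_add_two]
      exact div_pos (add_pos (mul_pos (ih1 _) (ih1 _)) (mul_pos (mul_pos hM (ih1 _)) (ih1 _))) ih0

theorem FVal_eq_partitionSum (k : ℕ) (hy : ∀ i, 0 < y i) (j : ℤ) :
    FVal y (k + 1) j = partitionSum y j k := by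
  induction k generalizing y with
  | zero => simp [FVal]
  | succ k ih =>
    have hy0 : ∀ i, y i ≠ 0 := fun i => (hy i).ne'
    have hy1 : ∀ i, 1 + y i ≠ 0 := fun i => (add_pos one_pos (hy i)).ne'
    rw [partitionSum_succ hy0 hy1 (c := j + k) (by simp),
      FVal_succ_eq_mutate hy0 hy1 (j + k) (k + 1) j (by push_cast; omega), ih (mutate_pos hy _)]

end Positivity

section Polynomial

open HeightFunction MvPolynomial

/-- The polynomial whose values are `partitionSum`. It is `F_{j,k}` by `algebraMap_FPoly`; the
truncation of the exponents to `ℕ` is harmless, as all exponents that occur are nonnegative. -/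
noncomputable def FPoly (j : ℤ) (k : ℕ) : YPoly :=
  ∑ b ∈ heights k, (∏ q ∈ sites (k - 1), X (idx j q) ^ (b q).toNat) *
    ∏ p ∈ sites k, ∑ x ∈ b.nextRange p, X (idx j p) ^ x.toNat

lemma aeval_FPoly {R : Type*} [CommRing R] (y : ℤ → R) (j : ℤ) (k : ℕ) :
    aeval y (FPoly j k) = ∑ b ∈ heights k, (∏ q ∈ sites (k - 1), y (idx j q) ^ (b q).toNat) *
      ∏ p ∈ sites k, ∑ x ∈ b.nextRange p, y (idx j p) ^ x.toNat := by
  simp only [FPoly, map_sum, map_mul, map_prod, map_pow, aeval_X]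

lemma aeval_FPoly_eq_partitionSum {K : Type*} [Field K] (y : ℤ → K) (j : ℤ) (k : ℕ) :
    aeval y (FPoly j k) = partitionSum y j k := by
  have pow_toNat : ∀ (i : ℤ) {x : ℤ}, 0 ≤ x → y i ^ x.toNat = y i ^ x := fun i x hx => by
    rw [← zpow_natCast, Int.toNat_of_nonneg hx]
  rw [aeval_FPoly]
  refine sum_congr rfl fun b hb => ?_
  have nonneg := nonneg_of_mem_heights hb
  congr 1
  · exact prod_congr rfl fun q _ => pow_toNat _ (nonneg q)
  · exact prod_congr rfl fun p _ => sum_congr rfl fun x hx =>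
      pow_toNat _ ((nonneg _).trans (mem_nextRange.1 hx).1.1)

lemma eq_of_aeval_eq_of_pos {P Q : YPoly}
    (h : ∀ y : ℤ → ℚ, (∀ i, 0 < y i) → aeval y P = aeval y Q) : P = Q := by
  refine MvPolynomial.funext_set (fun _ => Set.Ioi 0) (fun _ => Set.Ioi_infinite 0) fun y hy => ?_
  have heq := h (algebraMap ℤ ℚ ∘ y) fun i => by simpa using hy i (Set.mem_univ i)
  rw [aeval_algebraMap_apply, aeval_algebraMap_apply] at heq
  simpa [coe_aeval_eq_eval] using heq

lemma aeval_FPoly_eq_FVal {y : ℤ → ℚ} (hy : ∀ i, 0 < y i) (j : ℤ) (k : ℕ) :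
    aeval y (FPoly j k) = FVal y (k + 1) j := by
  rw [aeval_FPoly_eq_partitionSum, FVal_eq_partitionSum k hy]

lemma FPoly_ne_zero (j : ℤ) (k : ℕ) : FPoly j k ≠ 0 := by
  intro h
  have hval := aeval_FPoly_eq_FVal (y := fun _ => 1) (fun _ => one_pos) j k
  rw [h, map_zero] at hval
  exact (FVal_pos (fun _ => one_pos) (k + 1) j).ne hval

lemma FPoly_zero (j : ℤ) : FPoly j 0 = 1 :=
  eq_of_aeval_eq_of_pos fun y hy => by rw [aeval_FPoly_eq_FVal hy, map_one, FVal]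

lemma FPoly_one (j : ℤ) : FPoly j 1 = 1 + M j 0 :=
  eq_of_aeval_eq_of_pos fun y hy => by
    rw [aeval_FPoly_eq_FVal hy]
    simp [FVal, M]

lemma FPoly_condensation (j : ℤ) (k : ℕ) : FPoly j (k + 2) * FPoly j k =
    FPoly (j - 3) (k + 1) * FPoly (j + 3) (k + 1) +
      M j (k + 1) * FPoly (j - 1) (k + 1) * FPoly (j + 1) (k + 1) := by
  refine eq_of_aeval_eq_of_pos fun y hy => ?_
  simp only [map_mul, map_add, aeval_FPoly_eq_FVal hy, M, map_prod, aeval_X]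
  rw [FVal_add_two y (k + 1) j, div_mul_cancel₀ _ (FVal_pos hy _ _).ne']

theorem algebraMap_FPoly (k : ℕ) : ∀ j, algebraMap YPoly YRat (FPoly j k) = F j k := by
  unfold F
  induction k using Nat.strong_induction_on with
  | _ k ih =>
    match k, ih with
    | 0, _ => simp [Fshift, FPoly_zero]
    | 1, _ => simp [Fshift, FPoly_one]
    | k + 2, ih =>
      intro j
      have ih1 := ih (k + 1) (by omega)
      have ih0 := ih k (by omega) j
      have ne_zero : algebraMap YPoly YRat (FPoly j k) ≠ 0 :=
        (FaithfulSMul.algebraMap_eq_zero_iff ..).not.2 (FPoly_ne_zero j k)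
      rw [Fshift, ← ih1, ← ih1, ← ih1, ← ih1, ← ih0, eq_div_iff ne_zero, ← map_mul,
        FPoly_condensation]
      simp only [map_add, map_mul]

end Polynomial

/-! ### Alternating sign matrices -/

/-- A row or column of an alternating sign matrix of size `k`. Since the entries are differences of
consecutive partial sums, this condition says that they lie in `{-1, 0, 1}`, that the nonzero ones
alternate in sign, and that the first and the last of these are `1`. -/
structure IsASMLine (k : ℕ) (f : ℕ → ℤ) : Prop where
  partial_sum : ∀ m ≤ k, ∑ i ∈ range m, f i = 0 ∨ ∑ i ∈ range m, f i = 1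
  sum_eq_one : ∑ i ∈ range k, f i = 1

/-- Alternating sign matrices of size `k`, with rows and columns indexed from `0`. Only the values
`α u v` with `u, v < k` matter. -/
structure IsASM (k : ℕ) (α : ℕ → ℕ → ℤ) : Prop where
  row : ∀ u < k, IsASMLine k (α u)
  col : ∀ v < k, IsASMLine k fun u => α u v

namespace HeightFunction

/-- The matrix of size `k` of a height function on the array of size `k - 1`. -/
def matrix (b : HeightFunction) (k u v : ℕ) : ℤ := b.entry (cell k u v)

section Matrix

variable {b : HeightFunction} {k : ℕ}

lemma matrix_eq_corner (b : HeightFunction) (k u v : ℕ) :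
    b.matrix k u v = (b.corner k (u + 1) (v + 1) - b.corner k u (v + 1)) -
      (b.corner k (u + 1) v - b.corner k u v) := by
  rw [matrix, entry, east_cell, west_cell, north_cell, south_cell]
  ring

lemma corner_zero_left (hb : b.support ⊆ sites (k - 1)) (v : ℕ) : b.corner k 0 v = 0 := by
  rw [corner_boundary hb (by omega)]
  omega

lemma corner_zero_right (hb : b.support ⊆ sites (k - 1)) (u : ℕ) : b.corner k u 0 = 0 := by
  rw [corner_boundary hb (by omega)]
  omega

lemma sum_matrix_row (hb : b.support ⊆ sites (k - 1)) (u v : ℕ) :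
    ∑ v' ∈ range v, b.matrix k u v' = b.corner k (u + 1) v - b.corner k u v := by
  simp only [matrix_eq_corner]
  rw [sum_range_sub fun v' => b.corner k (u + 1) v' - b.corner k u v', corner_zero_right hb,
    corner_zero_right hb, sub_self, sub_zero]

lemma sum_matrix_col (hb : b.support ⊆ sites (k - 1)) (u v : ℕ) :
    ∑ u' ∈ range u, b.matrix k u' v = b.corner k u (v + 1) - b.corner k u v := by
  simp only [matrix_eq_corner, sub_sub_sub_comm _ (b.corner k _ (v + 1))]
  rw [sum_range_sub fun u' => b.corner k u' (v + 1) - b.corner k u' v, corner_zero_left hb,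
    corner_zero_left hb, sub_self, sub_zero]

lemma corner_eq_sum (hb : b.support ⊆ sites (k - 1)) (u v : ℕ) :
    b.corner k u v = ∑ u' ∈ range u, ∑ v' ∈ range v, b.matrix k u' v' := by
  simp only [sum_matrix_row hb]
  rw [sum_range_sub fun u' => b.corner k u' v, corner_zero_left hb, sub_zero]

lemma isASM_matrix (hb : b ∈ heights k) : IsASM k (b.matrix k) := by
  obtain ⟨hs, hadm⟩ := mem_heights.1 hb
  constructor
  · refine fun u hu => ⟨fun v _ => ?_, ?_⟩
    · rw [sum_matrix_row hs]
      have := hadm.corner_succ_left k u v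
      omega
    · rw [sum_matrix_row hs, corner_boundary hs (by omega), corner_boundary hs (by omega)]
      omega
  · refine fun v hv => ⟨fun u _ => ?_, ?_⟩
    · rw [sum_matrix_col hs]
      have := hadm.corner_succ_right k u v
      omega
    · rw [sum_matrix_col hs, corner_boundary hs (by omega), corner_boundary hs (by omega)]
      omega

lemma eq_of_matrix_eq {b' : HeightFunction} (hb : b.support ⊆ sites (k - 1))
    (hb' : b'.support ⊆ sites (k - 1))
    (h : ∀ u < k, ∀ v < k, b.matrix k u v = b'.matrix k u v) : b = b' := by
  ext q
  by_cases hq : q ∈ sites (k - 1)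
  · obtain ⟨u, hu, v, hv, rfl⟩ := exists_eq_vertex hq
    have hcorner : b.corner k u v = b'.corner k u v := by
      rw [corner_eq_sum hb, corner_eq_sum hb']
      exact sum_congr rfl fun u' hu' => sum_congr rfl fun v' hv' =>
        h u' ((mem_range.1 hu').trans_le hu) v' ((mem_range.1 hv').trans_le hv)
    simpa [corner] using hcorner
  · rw [eq_zero_of_notMem hb hq, eq_zero_of_notMem hb' hq]

/-- The height function whose corner sums are those of a given alternating sign matrix. -/
noncomputable def ofMatrix (k : ℕ) (α : ℕ → ℕ → ℤ) : HeightFunction :=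
  Finsupp.indicator (sites (k - 1)) fun p _ =>
    min ((p.1 + k) / 2) ((p.2 + k) / 2) -
      ∑ u ∈ range ((p.1 + k) / 2).toNat, ∑ v ∈ range ((p.2 + k) / 2).toNat, α u v

lemma support_ofMatrix (k : ℕ) (α : ℕ → ℕ → ℤ) : (ofMatrix k α).support ⊆ sites (k - 1) :=
  Finsupp.support_indicator_subset _ _

variable {α : ℕ → ℕ → ℤ}

lemma corner_ofMatrix (hα : IsASM k α) {u v : ℕ} (hu : u ≤ k) (hv : v ≤ k) :
    (ofMatrix k α).corner k u v = ∑ u' ∈ range u, ∑ v' ∈ range v, α u' v' := by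
  by_cases h : vertex k u v ∈ sites (k - 1)
  · rw [corner, ofMatrix, Finsupp.indicator_of_mem h]
    simp [vertex]
  · rw [vertex_mem_sites] at h
    have boundary : u = 0 ∨ v = 0 ∨ u = k ∨ v = k := by omega
    rw [corner_boundary (support_ofMatrix k α) boundary]
    rcases boundary with rfl | rfl | rfl | rfl
    · simp
    · simp
    · rw [sum_comm, sum_congr rfl fun v' hv' =>
        (hα.col v' ((mem_range.1 hv').trans_le hv)).sum_eq_one]
      simp [hv]
    · rw [sum_congr rfl fun u' hu' => (hα.row u' ((mem_range.1 hu').trans_le hu)).sum_eq_one]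
      simp [hu]

lemma matrix_ofMatrix (hα : IsASM k α) {u v : ℕ} (hu : u < k) (hv : v < k) :
    (ofMatrix k α).matrix k u v = α u v := by
  simp only [matrix_eq_corner, corner_ofMatrix hα, hu.le, hv.le, Nat.succ_le_of_lt hu,
    Nat.succ_le_of_lt hv, sum_range_succ, sum_add_distrib]
  ring

lemma corner_ofMatrix_succ_left (hα : IsASM k α) {u v : ℕ} (hu : u < k) (hv : v ≤ k) :
    (ofMatrix k α).corner k u v ≤ (ofMatrix k α).corner k (u + 1) v ∧
      (ofMatrix k α).corner k (u + 1) v ≤ (ofMatrix k α).corner k u v + 1 := by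
  rw [corner_ofMatrix hα hu.le hv, corner_ofMatrix hα hu hv, sum_range_succ]
  have := (hα.row u hu).partial_sum v hv
  omega

lemma corner_ofMatrix_succ_right (hα : IsASM k α) {u v : ℕ} (hu : u ≤ k) (hv : v < k) :
    (ofMatrix k α).corner k u v ≤ (ofMatrix k α).corner k u (v + 1) ∧
      (ofMatrix k α).corner k u (v + 1) ≤ (ofMatrix k α).corner k u v + 1 := by
  rw [corner_ofMatrix hα hu hv.le, corner_ofMatrix hα hu hv, sum_comm, sum_comm (s := range u),
    sum_range_succ]
  have := (hα.col v hv).partial_sum u hu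
  omega

lemma admissible_ofMatrix (hα : IsASM k α) : (ofMatrix k α).Admissible := by
  intro p _
  by_cases hp : p ∈ sites k
  · obtain ⟨u, hu, v, hv, rfl⟩ := exists_eq_cell hp
    have left := corner_ofMatrix_succ_left hα hu hv.le
    have left' := corner_ofMatrix_succ_left (v := v + 1) hα hu hv
    have right := corner_ofMatrix_succ_right hα hu.le hv
    have right' := corner_ofMatrix_succ_right (u := u + 1) hα hu hv
    rw [east_cell, west_cell, north_cell, south_cell]
    omega
  · obtain ⟨heast, hwest, hnorth, hsouth⟩ := neighbours_eq_zero (support_ofMatrix k α) hp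
    rw [east, west, north, south, heast, hwest, hnorth, hsouth]
    omega

lemma ofMatrix_mem_heights (hα : IsASM k α) : ofMatrix k α ∈ heights k :=
  mem_heights.2 ⟨support_ofMatrix k α, admissible_ofMatrix hα⟩

lemma eq_ofMatrix (hb : b ∈ heights k) (hα : IsASM k α)
    (h : ∀ u < k, ∀ v < k, b.matrix k u v = α u v) : b = ofMatrix k α :=
  eq_of_matrix_eq (mem_heights.1 hb).1 (support_ofMatrix k α) fun u hu v hv => by
    rw [h u hu v hv, matrix_ofMatrix hα hu hv]

end Matrix

end HeightFunction

section Expansion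

open HeightFunction MvPolynomial

variable {R : Type*} [CommRing R] (y : ℤ → R) (j : ℤ) (k : ℕ)

/-- The monomial of a height function in `heights k`, followed in the next layer by the lowest
heights compatible with it. As for `FPoly`, the exponents are nonnegative. -/
noncomputable def weight (b : HeightFunction) : R :=
  (∏ q ∈ sites (k - 1), y (idx j q) ^ (b q).toNat) *
    ∏ p ∈ sites k, y (idx j p) ^ (max (b.east p) (b.west p)).toNat

/-- The product of `1 + y` over the positions of the entries `1` of a matrix of size `k`. -/
def onesProd (α : ℕ → ℕ → ℤ) : R :=
  ∏ u ∈ range k, ∏ v ∈ range k, if α u v = 1 then 1 + y (idx j (cell k u v)) else 1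

variable {y j k}

lemma sum_pow_nextRange {b : HeightFunction} {p : ℤ × ℤ} (hb : b.Admissible)
    (hp : (p.1 + p.2) % 2 = 0) (h0 : 0 ≤ b.east p) (x : R) :
    ∑ i ∈ b.nextRange p, x ^ i.toNat =
      x ^ (max (b.east p) (b.west p)).toNat * if b.entry p = 1 then 1 + x else 1 := by
  have h0' : 0 ≤ max (b.east p) (b.west p) := h0.trans (le_max_left _ _)
  rw [hb.nextRange_eq hp]
  split_ifs
  · rw [sum_pair (by omega), Int.toNat_add h0' one_pos.le, Int.toNat_one, pow_succ]
    ring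
  · rw [sum_singleton, mul_one]

theorem aeval_FPoly_eq_sum_weight_mul_onesProd :
    aeval y (FPoly j k) = ∑ b ∈ heights k, weight y j k b * onesProd y j k (b.matrix k) := by
  rw [aeval_FPoly]
  refine sum_congr rfl fun b hb => ?_
  rw [weight, onesProd, mul_assoc]
  unfold matrix
  rw [← prod_sites (fun p => if b.entry p = 1 then 1 + y (idx j p) else 1), ← prod_mul_distrib]
  exact congrArg _ <| prod_congr rfl fun p hp =>
    sum_pow_nextRange (mem_heights.1 hb).2 (parity_of_mem_sites hp) (nonneg_of_mem_heights hb _) _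

lemma onesProd_eq_zero {α : ℕ → ℕ → ℤ} {u v : ℕ} (hu : u < k) (hv : v < k) (hα : α u v = 1)
    (h0 : y (idx j (cell k u v)) = -1) : onesProd y j k α = 0 := by
  refine prod_eq_zero (mem_range.2 hu) (prod_eq_zero (mem_range.2 hv) ?_)
  rw [if_pos hα, h0, add_neg_cancel]

lemma onesProd_matrix_ofMatrix {α : ℕ → ℕ → ℤ} (hα : IsASM k α) :
    onesProd y j k ((ofMatrix k α).matrix k) = onesProd y j k α :=
  prod_congr rfl fun u hu => prod_congr rfl fun v hv => by
    rw [matrix_ofMatrix hα (mem_range.1 hu) (mem_range.1 hv)]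

lemma aeval_FPoly_eq_sum_of_subset {B : Finset HeightFunction} (hB : B ⊆ heights k)
    (h : ∀ b ∈ heights k, (∀ u < k, ∀ v < k, b.matrix k u v = 1 → y (idx j (cell k u v)) ≠ -1) →
      b ∈ B) :
    aeval y (FPoly j k) = ∑ b ∈ B, weight y j k b * onesProd y j k (b.matrix k) := by
  rw [aeval_FPoly_eq_sum_weight_mul_onesProd]
  refine (sum_subset hB fun b hb hbB => ?_).symm
  have hne := mt (h b hb) hbB
  push Not at hne
  obtain ⟨u, hu, v, hv, hone, hneg⟩ := hne
  rw [onesProd_eq_zero hu hv hone hneg, mul_zero]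

end Expansion

namespace IsASMLine

variable {k : ℕ} {f f' : ℕ → ℤ}

lemma congr (hf : IsASMLine k f) (h : ∀ i < k, f i = f' i) : IsASMLine k f' := by
  have sum_congr_range : ∀ m ≤ k, ∑ i ∈ range m, f i = ∑ i ∈ range m, f' i := fun m hm =>
    sum_congr rfl fun i hi => h i ((mem_range.1 hi).trans_le hm)
  exact ⟨fun m hm => sum_congr_range m hm ▸ hf.partial_sum m hm,
    sum_congr_range k le_rfl ▸ hf.sum_eq_one⟩

lemma nonneg_zero (hf : IsASMLine k f) (hk : 0 < k) : 0 ≤ f 0 := by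
  have := hf.partial_sum 1 hk
  rw [sum_range_one] at this
  omega

lemma sum_range_eq_zero (hf : IsASMLine k f) {a b : ℕ} (hab : a ≤ b) (hb : b ≤ k)
    (ha : ∑ i ∈ range a, f i = 0) (hone : ∀ i, a ≤ i → i < b → f i ≠ 1) :
    ∑ i ∈ range b, f i = 0 := by
  induction b, hab using Nat.le_induction with
  | base => exact ha
  | succ b hab ih =>
    have sum_b := ih (by omega) fun i hi hi' => hone i hi (by omega)
    have sum_succ := hf.partial_sum (b + 1) hb
    have ne_one := hone b hab (by omega)
    rw [sum_range_succ, sum_b] at sum_succ ⊢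
    omega

lemma eq_single (hf : IsASMLine k f) {g : ℕ} (hone : ∀ i < k, f i = 1 → i = g) :
    ∀ i < k, f i = if i = g then 1 else 0 := by
  have partial_sum_eq : ∀ m ≤ k, ∑ i ∈ range m, f i = if g < m then 1 else 0 := by
    intro m hm
    split_ifs with hgm
    · refine (hf.partial_sum m hm).resolve_left fun hzero => ?_
      have := hf.sum_range_eq_zero hm le_rfl hzero fun i hi hik h1 => by
        have := hone i hik h1
        omega
      exact zero_ne_one (this.symm.trans hf.sum_eq_one)
    · refine hf.sum_range_eq_zero (Nat.zero_le m) hm (sum_range_zero _) fun i _ him h1 => ?_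
      have := hone i (by omega) h1
      omega
  intro i hi
  have sum_i := partial_sum_eq i hi.le
  have sum_succ := partial_sum_eq (i + 1) hi
  rw [sum_range_succ, sum_i] at sum_succ
  split_ifs at sum_succ ⊢ <;> omega

end IsASMLine

lemma sum_range_single (m a : ℕ) :
    ∑ i ∈ range m, (if i = a then (1 : ℤ) else 0) = if a < m then 1 else 0 := by
  simp

lemma isASMLine_single {k a : ℕ} (ha : a < k) : IsASMLine k fun i => if i = a then 1 else 0 where
  partial_sum m _ := by
    rw [sum_range_single]
    omega
  sum_eq_one := by rw [sum_range_single, if_pos ha]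

/-- The matrix of the map `g`, with the entry `1` of row `u` in column `g u`. -/
def permMatrix (g : ℕ → ℕ) (u v : ℕ) : ℤ := if v = g u then 1 else 0

/-- The matrix of size `n + 1` with entries `1` at the positions `(u, g u)`, `(h v, v)`, and one
entry `-1` at `(h 0, g 0)`. -/
def extendedMatrix (n : ℕ) (g h : ℕ → ℕ) (u v : ℕ) : ℤ :=
  (if v = g u then 1 else 0) +
    if u = h 0 then (if v = n then 1 else 0) - (if v = g 0 then 1 else 0) else 0

lemma isASM_permMatrix {k : ℕ} {g h : ℕ → ℕ} (hg : ∀ u < k, g u < k) (hh : ∀ v < k, h v < k)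
    (hgh : ∀ u < k, ∀ v < k, (v = g u ↔ u = h v)) : IsASM k (permMatrix g) where
  row u hu := isASMLine_single (hg u hu)
  col v hv := (isASMLine_single (hh v hv)).congr fun u hu => by
    simp only [permMatrix, hgh u hu v hv]

namespace IsASM

variable {k : ℕ} {α β : ℕ → ℕ → ℤ}

lemma eq_of_eq_off_row (hα : IsASM k α) (hβ : IsASM k β) (u₀ : ℕ)
    (h : ∀ u < k, u ≠ u₀ → ∀ v < k, α u v = β u v) : ∀ u < k, ∀ v < k, α u v = β u v := by
  intro u hu v hv
  by_cases hu₀ : u = u₀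
  · subst hu₀
    have sumα := (hα.col v hv).sum_eq_one
    have sumβ := (hβ.col v hv).sum_eq_one
    rw [← add_sum_erase _ _ (mem_range.2 hu)] at sumα sumβ
    rw [sum_congr rfl fun u' hu' => h u' (mem_range.1 (mem_of_mem_erase hu'))
      (ne_of_mem_erase hu') v hv] at sumα
    omega
  · exact h u hu hu₀ v hv

lemma eq_of_first_row_eq_one (hα : IsASM k α) {v v' : ℕ} (hv : v < k) (hv' : v' < k)
    (h : α 0 v = 1) (h' : α 0 v' = 1) : v = v' := by
  by_contra hne
  have hk : 0 < k := by omega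
  have pair_le := sum_le_sum_of_subset_of_nonneg (f := α 0)
    (show {v, v'} ⊆ range k by simp [insert_subset_iff, hv, hv'])
    fun i hi _ => (hα.col i (mem_range.1 hi)).nonneg_zero hk
  rw [sum_pair hne, h, h', (hα.row 0 hk).sum_eq_one] at pair_le
  omega

end IsASM

/-- The set of positions `G`, periodic in both directions with period `n`, meets every row and every
column once in each period. The functions `g` and `h` give the columns and the rows of these
positions in the square of size `n`. -/
structure IsTransversal (n : ℕ) (G : ℕ → ℕ → Prop) (g h : ℕ → ℕ) : Prop where
  g_lt : ∀ u, g u < n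
  h_lt : ∀ v, h v < n
  row : ∀ u v, v < n → (G u v ↔ v = g u)
  col : ∀ u v, u < n → (G u v ↔ u = h v)
  right : ∀ u, G u n ↔ G u 0
  bottom : ∀ v, G n v ↔ G 0 v

lemma dvd_sub_iff_eq_toNat_emod {n v : ℕ} (hv : v < n) (w : ℤ) :
    (n : ℤ) ∣ v - w ↔ v = (w % n).toNat := by
  have hn : (n : ℤ) ≠ 0 := by omega
  have nonneg := Int.emod_nonneg w hn
  rw [← Int.modEq_iff_dvd, Int.ModEq, Int.emod_eq_of_lt (a := (v : ℤ)) (by omega) (by omega)]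
  omega

lemma exists_isTransversal {n : ℕ} (hn : Odd n) (c : ℤ) :
    ∃ g h : ℕ → ℕ, IsTransversal n (fun u v => (n : ℤ) ∣ 2 * u + v - c) g h := by
  have hn0 : (0 : ℤ) < n := by exact_mod_cast hn.pos
  obtain ⟨t, ht⟩ := hn
  have toNat_lt : ∀ w : ℤ, (w % n).toNat < n := fun w => by
    have := Int.emod_lt_of_pos w hn0
    omega
  refine ⟨fun u => ((c - 2 * u) % n).toNat, fun v => (((t + 1) * (c - v)) % n).toNat,
    fun u => toNat_lt _, fun v => toNat_lt _, fun u v hv => ?row, fun u v hu => ?col,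
    fun u => ?right, fun v => ?bottom⟩
  case row =>
    rw [← dvd_sub_iff_eq_toNat_emod hv]
    ring_nf
  case col =>
    -- `t + 1` is the inverse of `2` modulo `n = 2 * t + 1`
    rw [← dvd_sub_iff_eq_toNat_emod hu]
    have hnt : (n : ℤ) = 2 * t + 1 := by exact_mod_cast ht
    constructor
    · rintro ⟨q, hq⟩
      exact ⟨(t + 1) * q - u, by linear_combination ((t : ℤ) + 1) * hq + u * hnt⟩
    · rintro ⟨q, hq⟩
      exact ⟨2 * q + (c - v), by linear_combination 2 * hq - (c - v) * hnt⟩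
  case right =>
    rw [show (2 * u + n - c : ℤ) = 2 * u + (0 : ℕ) - c + n by push_cast; ring, dvd_add_self_right]
  case bottom =>
    rw [show (2 * n + v - c : ℤ) = 2 * (0 : ℕ) + v - c + n * 2 by push_cast; ring,
      dvd_add_left (dvd_mul_right _ _)]

namespace IsTransversal

variable {n : ℕ} {G : ℕ → ℕ → Prop} {g h : ℕ → ℕ} {β : ℕ → ℕ → ℤ}

lemma symm (hG : IsTransversal n G g h) : IsTransversal n (fun u v => G v u) h g where
  g_lt := hG.h_lt
  h_lt := hG.g_lt
  row u v hv := hG.col v u hv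
  col u v hu := hG.row v u hu
  right := hG.bottom
  bottom := hG.right

lemma pos (hG : IsTransversal n G g h) : 0 < n :=
  (Nat.zero_le _).trans_lt (hG.g_lt 0)

lemma self_mem (hG : IsTransversal n G g h) (u : ℕ) : G u (g u) :=
  (hG.row u _ (hG.g_lt u)).2 rfl

lemma zero_mem_iff (hG : IsTransversal n G g h) {u : ℕ} : G u 0 ↔ g u = 0 := by
  rw [hG.row u 0 hG.pos, eq_comm]

lemma eq_iff_eq (hG : IsTransversal n G g h) {u v : ℕ} (hu : u < n) (hv : v < n) :
    v = g u ↔ u = h v := by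
  rw [← hG.row u v hv, hG.col u v hu]

lemma g_last (hG : IsTransversal n G g h) : g n = g 0 :=
  ((hG.row n _ (hG.g_lt 0)).1 ((hG.bottom _).2 (hG.self_mem 0))).symm

lemma g_zero_iff (hG : IsTransversal n G g h) : g 0 = 0 ↔ h 0 = 0 := by
  rw [eq_comm, hG.eq_iff_eq hG.pos hG.pos, eq_comm]

lemma pos_of_pos (hG : IsTransversal n G g h) (h0 : g 0 = 0) {u : ℕ} (hu : 0 < u) (hun : u < n) :
    0 < g u := by
  have := hG.eq_iff_eq hun hG.pos
  have := hG.g_zero_iff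
  omega

lemma isASM_permMatrix (hG : IsTransversal n G g h) : IsASM n (permMatrix g) :=
  Pentagram.isASM_permMatrix (fun u _ => hG.g_lt u) (fun v _ => hG.h_lt v) fun _ hu _ hv =>
    hG.eq_iff_eq hu hv

lemma eq_permMatrix (hG : IsTransversal n G g h) (hβ : IsASM n β)
    (hone : ∀ u < n, ∀ v < n, β u v = 1 → G u v) : ∀ u < n, ∀ v < n, β u v = permMatrix g u v :=
  fun u hu => (hβ.row u hu).eq_single fun v hv hv1 => (hG.row u v hv).1 (hone u hu v hv hv1)

lemma row_eq_single (hG : IsTransversal n G g h) (hβ : IsASM (n + 1) β)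
    (hone : ∀ u < n + 1, ∀ v < n + 1, β u v = 1 → G u v) {u : ℕ} (hu : u < n + 1)
    (h0 : ¬ G u 0) : ∀ v < n + 1, β u v = if v = g u then 1 else 0 := by
  refine (hβ.row u hu).eq_single fun v hv hv1 => ?_
  have mem := hone u hu v hv hv1
  rcases (Nat.lt_succ_iff.1 hv).lt_or_eq with hv | rfl
  · exact (hG.row u v hv).1 mem
  · exact absurd ((hG.right u).1 mem) h0

lemma g_eq_zero_iff (hG : IsTransversal n G g h) (h0 : g 0 ≠ 0) {u : ℕ} (hu : u < n + 1) :
    g u = 0 ↔ u = h 0 := by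
  have h_lt := hG.h_lt 0
  have g_last := hG.g_last
  rcases (Nat.lt_succ_iff.1 hu).lt_or_eq with hu | rfl
  · rw [← hG.eq_iff_eq hu hG.pos, eq_comm]
  · omega

lemma extendedMatrix_eq_one_iff (hG : IsTransversal n G g h) (h0 : g 0 ≠ 0) {u v : ℕ}
    (hu : u < n + 1) : extendedMatrix n g h u v = 1 ↔ v = g u ∨ (u = h 0 ∧ v = n) := by
  have g_lt := hG.g_lt 0
  have g_eq_zero := hG.g_eq_zero_iff h0 hu
  rw [extendedMatrix]
  split_ifs <;> omega

lemma extendedMatrix_transpose (hG : IsTransversal n G g h) (h0 : g 0 ≠ 0) {u v : ℕ}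
    (hu : u < n + 1) (hv : v < n + 1) :
    extendedMatrix n g h u v = extendedMatrix n h g v u := by
  have : h 0 ≠ 0 := mt hG.g_zero_iff.2 h0
  have g_last := hG.g_last
  have h_last := hG.symm.g_last
  have gu_lt := hG.g_lt u
  have hv_lt := hG.h_lt v
  have inverse := fun hu hv => hG.eq_iff_eq (u := u) (v := v) hu hv
  simp only [extendedMatrix]
  rcases (Nat.lt_succ_iff.1 hu).lt_or_eq with hu | rfl <;>
    rcases (Nat.lt_succ_iff.1 hv).lt_or_eq with hv | rfl
  · have := inverse hu hv
    split_ifs <;> omega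
  all_goals split_ifs <;> omega

lemma isASMLine_extendedMatrix (hG : IsTransversal n G g h) (h0 : g 0 ≠ 0) {u : ℕ}
    (hu : u < n + 1) : IsASMLine (n + 1) (extendedMatrix n g h u) := by
  have gu_lt := hG.g_lt u
  have g0_lt := hG.g_lt 0
  have g_eq_zero := hG.g_eq_zero_iff h0 hu
  have sum_eq : ∀ m, ∑ v ∈ range m, extendedMatrix n g h u v =
      (if g u < m then 1 else 0) +
        if u = h 0 then (if n < m then 1 else 0) - (if g 0 < m then 1 else 0) else 0 := by
    intro m
    simp only [extendedMatrix, sum_add_distrib, sum_range_single]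
    split_ifs <;> simp [*]
  refine ⟨fun m hm => ?_, ?_⟩
  all_goals
    rw [sum_eq]
    split_ifs <;> omega

lemma isASM_extendedMatrix (hG : IsTransversal n G g h) (h0 : g 0 ≠ 0) :
    IsASM (n + 1) (extendedMatrix n g h) where
  row _ hu := hG.isASMLine_extendedMatrix h0 hu
  col _ hv := (hG.symm.isASMLine_extendedMatrix (mt hG.g_zero_iff.2 h0) hv).congr fun _ hu =>
    (hG.extendedMatrix_transpose h0 hu hv).symm

lemma eq_extendedMatrix (hG : IsTransversal n G g h) (h0 : g 0 ≠ 0) (hβ : IsASM (n + 1) β)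
    (hone : ∀ u < n + 1, ∀ v < n + 1, β u v = 1 → G u v) :
    ∀ u < n + 1, ∀ v < n + 1, β u v = extendedMatrix n g h u v := by
  refine hβ.eq_of_eq_off_row (hG.isASM_extendedMatrix h0) (h 0) fun u hu hne v hv => ?_
  have notMem : ¬ G u 0 := by rwa [hG.zero_mem_iff, hG.g_eq_zero_iff h0 hu]
  rw [hG.row_eq_single hβ hone hu notMem v hv, extendedMatrix, if_neg hne, add_zero]

section Update

variable {a : ℕ}

lemma update_mem (hG : IsTransversal n G g h) (h0 : g 0 = 0) (ha : a = 0 ∨ a = n) (u : ℕ) :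
    G u (Function.update g a n u) := by
  have zero_mem : G 0 0 := hG.zero_mem_iff.2 h0
  rcases eq_or_ne u a with rfl | hne
  · rw [Function.update_self, hG.right]
    rcases ha with rfl | rfl
    · exact zero_mem
    · exact (hG.bottom 0).2 zero_mem
  · rw [Function.update_of_ne hne]
    exact hG.self_mem u

lemma update_lt (hG : IsTransversal n G g h) (u : ℕ) : Function.update g a n u < n + 1 := by
  have := hG.g_lt u
  rw [Function.update_apply]
  split_ifs <;> omega

lemma isASM_permMatrix_update (hG : IsTransversal n G g h) (h0 : g 0 = 0) (ha : a = 0 ∨ a = n) :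
    IsASM (n + 1) (permMatrix (Function.update g a n)) := by
  have h_zero := hG.g_zero_iff.1 h0
  have g_last := hG.g_last
  have h_last := hG.symm.g_last
  have pos := hG.pos
  refine Pentagram.isASM_permMatrix (fun u _ => hG.update_lt u)
    (fun v _ => hG.symm.update_lt (a := a) v) fun u hu v hv => ?_
  have gu_lt := hG.g_lt u
  have hv_lt := hG.h_lt v
  rw [Function.update_apply, Function.update_apply]
  rcases (Nat.lt_succ_iff.1 hu).lt_or_eq with hun | rfl <;>
    rcases (Nat.lt_succ_iff.1 hv).lt_or_eq with hvn | rfl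
  · have := hG.eq_iff_eq hun hvn
    have := hG.eq_iff_eq hun hG.pos
    have := hG.eq_iff_eq hG.pos hvn
    split_ifs <;> grind
  all_goals split_ifs <;> grind

lemma eq_permMatrix_update (hG : IsTransversal n G g h) (h0 : g 0 = 0) (hβ : IsASM (n + 1) β)
    (hone : ∀ u < n + 1, ∀ v < n + 1, β u v = 1 → G u v) :
    ∃ a, (a = 0 ∨ a = n) ∧
      ∀ u < n + 1, ∀ v < n + 1, β u v = permMatrix (Function.update g a n) u v := by
  have pos := hG.pos
  have first_row : ∀ v < n + 1, β 0 v = 1 → v = 0 ∨ v = n := fun v hv hv1 => by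
    have := (hG.row 0 v · |>.1 (hone 0 (by omega) v hv hv1))
    omega
  obtain ⟨a, ha, row_zero⟩ : ∃ a, (a = 0 ∨ a = n) ∧
      ∀ v < n + 1, β 0 v = permMatrix (Function.update g a n) 0 v := by
    by_cases h1 : β 0 0 = 1
    · refine ⟨n, Or.inr rfl, ?_⟩
      simp only [permMatrix, Function.update_of_ne pos.ne, h0]
      exact (hβ.row 0 (by omega)).eq_single fun v hv hv1 =>
        hβ.eq_of_first_row_eq_one hv (by omega) hv1 h1
    · refine ⟨0, Or.inl rfl, ?_⟩
      simp only [permMatrix, Function.update_self]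
      refine (hβ.row 0 (by omega)).eq_single fun v hv hv1 => (first_row v hv hv1).resolve_left ?_
      rintro rfl
      exact h1 hv1
  refine ⟨a, ha, hβ.eq_of_eq_off_row (hG.isASM_permMatrix_update h0 ha) n fun u hu hun v hv => ?_⟩
  rcases Nat.eq_zero_or_pos u with rfl | hu0
  · exact row_zero v hv
  · have notMem : ¬ G u 0 := by
      rw [hG.zero_mem_iff]
      exact (hG.pos_of_pos h0 hu0 (by omega)).ne'
    rw [hG.row_eq_single hβ hone hu notMem v hv, permMatrix, Function.update_of_ne (by omega)]

end Update

end IsTransversal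

/-! ### The special family -/

section Periodic

variable {A : Type*} [CommMonoid A]

lemma apply_eq_of_modEq {β : Type*} {f : ℤ → β} {N a b : ℤ} (hf : Function.Periodic f N)
    (h : a ≡ b [ZMOD N]) : f a = f b := by
  obtain ⟨t, rfl⟩ := Int.modEq_iff_add_fac.1 h
  rw [mul_comm]
  exact (hf.int_mul t a).symm

lemma prod_range_add_eq_of_periodic {n : ℕ} {f : ℤ → A} (hf : Function.Periodic f n) (t : ℤ) :
    ∏ v ∈ range n, f (t + v) = ∏ v ∈ range n, f v := by
  have prod_add_one : ∀ t : ℤ, ∏ v ∈ range n, f (t + 1 + v) = ∏ v ∈ range n, f (t + v) := by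
    intro t
    rcases n with - | n
    · simp
    · rw [prod_range_succ, prod_range_succ', Nat.cast_zero, add_zero, ← hf t]
      push_cast
      simp only [add_assoc, add_comm (1 : ℤ)]
  induction t using Int.induction_on with
  | zero => simp
  | succ t ih => rw [prod_add_one, ih]
  | pred t ih => rw [← ih, ← prod_add_one, sub_add_cancel]

lemma exists_exponents {ι : Type*} (s : Finset ι) (f : ι → ℤ) (ε : ι → ℕ) {N : ℤ} (hN : 0 < N) :
    ∃ m : ℤ → ℕ, ∀ (A : Type*) [CommMonoid A] (y : ℤ → A), Function.Periodic y N →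
      ∏ t ∈ s, y (f t) ^ ε t = ∏ i ∈ Icc 1 N, y i ^ m i := by
  let residue : ℤ → ℤ := fun i => (i - 1) % N + 1
  refine ⟨fun i => ∑ t ∈ s with residue (f t) = i, ε t, fun A _ y hy => ?_⟩
  have apply_residue : ∀ i, y (residue i) = y i := fun i => apply_eq_of_modEq hy <| by
    simpa [residue] using (Int.mod_modEq (i - 1) N).add_right 1
  rw [← prod_fiberwise_of_maps_to (t := Icc 1 N) (g := fun t => residue (f t)) fun t _ => ?_]
  · refine prod_congr rfl fun i _ => ?_
    rw [← prod_pow_eq_pow_sum]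
    refine prod_congr rfl fun t ht => ?_
    rw [← apply_residue, (mem_filter.1 ht).2]
  · have := Int.emod_nonneg (f t - 1) hN.ne'
    have := Int.emod_lt_of_pos (f t - 1) hN
    simp only [residue, mem_Icc]
    omega

lemma prod_Icc_two_mul (y : ℤ → A) (m : ℕ) : ∏ i ∈ Icc (1 : ℤ) (2 * (m : ℤ)), y i =
    (∏ i ∈ range m, y (1 + 2 * (i : ℤ))) * ∏ i ∈ range m, y (2 * (1 + (i : ℤ))) := by
  induction m with
  | zero => simp
  | succ m ih =>
    have Icc_succ : Icc (1 : ℤ) (2 * ((m + 1 : ℕ) : ℤ)) =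
        insert (2 * (1 + (m : ℤ))) (insert (1 + 2 * (m : ℤ)) (Icc 1 (2 * (m : ℤ)))) := by
      ext x
      simp only [mem_insert, mem_Icc]
      omega
    rw [Icc_succ, prod_insert (by simp only [mem_insert, mem_Icc]; omega),
      prod_insert (by simp only [mem_Icc]; omega), ih, prod_range_succ, prod_range_succ,
      mul_left_comm, ← mul_assoc, mul_mul_mul_comm, mul_comm (y _), mul_left_comm]
    simp only [mul_comm, mul_left_comm, mul_assoc]

end Periodic

section Specialization

open HeightFunction MvPolynomial

variable {R : Type*} [CommRing R] {y : ℤ → R} {j : ℤ} {k n : ℕ}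

lemma exists_exponents_weight (j : ℤ) (k : ℕ) (b : HeightFunction) {N : ℤ} (hN : 0 < N) :
    ∃ m : ℤ → ℕ, ∀ (R : Type*) [CommRing R] (y : ℤ → R), Function.Periodic y N →
      weight y j k b = ∏ i ∈ Icc 1 N, y i ^ m i := by
  obtain ⟨m, hm⟩ := exists_exponents (sites (k - 1)) (idx j) (fun q => (b q).toNat) hN
  obtain ⟨m', hm'⟩ := exists_exponents (sites k) (idx j)
    (fun p => (max (b.east p) (b.west p)).toNat) hN
  refine ⟨m + m', fun R _ y hy => ?_⟩
  simp only [Pi.add_apply, pow_add, prod_mul_distrib]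
  rw [weight, hm R y hy, hm' R y hy]

lemma aeval_FPoly_eq_sum_ofMatrix {ι : Type*} {s : Finset ι} {α : ι → ℕ → ℕ → ℤ}
    (hα : ∀ i ∈ s, IsASM k (α i)) (hinj : Set.InjOn (fun i => ofMatrix k (α i)) s)
    (h : ∀ β, IsASM k β → (∀ u < k, ∀ v < k, β u v = 1 → y (idx j (cell k u v)) ≠ -1) →
      ∃ i ∈ s, ∀ u < k, ∀ v < k, β u v = α i u v) :
    aeval y (FPoly j k) = ∑ i ∈ s, weight y j k (ofMatrix k (α i)) * onesProd y j k (α i) := by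
  classical
  rw [aeval_FPoly_eq_sum_of_subset (B := s.image fun i => ofMatrix k (α i)), sum_image hinj]
  · exact sum_congr rfl fun i hi => by rw [onesProd_matrix_ofMatrix (hα i hi)]
  · exact image_subset_iff.2 fun i hi => ofMatrix_mem_heights (hα i hi)
  · intro b hb hone
    obtain ⟨i, hi, hbi⟩ := h _ (isASM_matrix hb) hone
    exact mem_image.2 ⟨i, hi, (eq_ofMatrix hb (hα i hi) hbi).symm⟩

/-- The number of entries `1` of a matrix of size `k`. -/
def onesCount (k : ℕ) (α : ℕ → ℕ → ℤ) : ℕ := ∑ u ∈ range k, #{v ∈ range k | α u v = 1}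

lemma onesProd_eq_pow {α : ℕ → ℕ → ℤ} {x : R}
    (hx : ∀ u < k, ∀ v < k, α u v = 1 → y (idx j (cell k u v)) = x) :
    onesProd y j k α = (1 + x) ^ onesCount k α := by
  rw [onesProd, onesCount, ← prod_pow_eq_pow_sum]
  refine prod_congr rfl fun u hu => ?_
  rw [← prod_const, prod_filter]
  refine prod_congr rfl fun v hv => ite_congr rfl (fun hone => ?_) fun _ => rfl
  rw [hx u (mem_range.1 hu) v (mem_range.1 hv) hone]

lemma permMatrix_eq_one_iff {g : ℕ → ℕ} {u v : ℕ} : permMatrix g u v = 1 ↔ v = g u := by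
  simp [permMatrix]

lemma onesCount_permMatrix {g : ℕ → ℕ} (hg : ∀ u < k, g u < k) :
    onesCount k (permMatrix g) = k := by
  have card_row : ∀ u ∈ range k, #{v ∈ range k | permMatrix g u v = 1} = 1 := fun u hu => by
    simp only [permMatrix_eq_one_iff, filter_eq', mem_range, hg u (mem_range.1 hu), if_true,
      card_singleton]
  rw [onesCount, sum_congr rfl card_row, sum_const, card_range, smul_eq_mul, mul_one]

lemma IsTransversal.onesCount_extendedMatrix {G : ℕ → ℕ → Prop} {g h : ℕ → ℕ}
    (hG : IsTransversal n G g h) (h0 : g 0 ≠ 0) :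
    onesCount (n + 1) (extendedMatrix n g h) = n + 2 := by
  have card_row : ∀ u ∈ range (n + 1), #{v ∈ range (n + 1) | extendedMatrix n g h u v = 1} =
      1 + if u = h 0 then 1 else 0 := by
    intro u hu
    have g_lt := hG.g_lt u
    simp only [hG.extendedMatrix_eq_one_iff h0 (mem_range.1 hu)]
    split_ifs with hu0
    · rw [one_add_one_eq_two, ← card_pair g_lt.ne]
      congr 1
      ext v
      simp only [mem_filter, mem_range, mem_insert, mem_singleton]
      omega
    · simp only [hu0, false_and, or_false, filter_eq', mem_range, g_lt.trans n.lt_succ_self,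
        if_true, card_singleton]
  rw [onesCount, sum_congr rfl card_row, sum_add_distrib, sum_const, card_range, smul_eq_mul,
    mul_one, sum_ite_eq', if_pos (mem_range.2 ((hG.h_lt 0).trans n.lt_succ_self))]

/-- The specializations `y` of period `2 * n` in which, up to periodicity, all variables of even
index apart from `y 0` are `-1`. -/
structure IsSpecial (n : ℕ) (y : ℤ → R) : Prop where
  periodic : Function.Periodic y (2 * n)
  eq_neg_one : ∀ i ∈ arithProg 2 (2 * n - 2) 2, y i = -1

namespace IsSpecial

lemma apply_two_mul (hy : IsSpecial n y) (hn : 0 < n) (t : ℤ) :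
    y (2 * t) = if (n : ℤ) ∣ t then y 0 else -1 := by
  have apply_mod : y (2 * t) = y (2 * (t % n)) :=
    apply_eq_of_modEq hy.periodic (Int.mod_modEq t n).symm.mul_left'
  have mod_nonneg := Int.emod_nonneg t (b := n) (by omega)
  have mod_lt := Int.emod_lt_of_pos t (b := n) (by omega)
  rw [apply_mod]
  split_ifs with h
  · rw [Int.emod_eq_zero_of_dvd h, mul_zero]
  · have mod_ne_zero : t % n ≠ 0 := mt Int.dvd_of_emod_eq_zero h
    refine hy.eq_neg_one _ ⟨by omega, by omega, ?_⟩
    rw [Int.ModEq]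
    omega

lemma apply_idx_cell (hy : IsSpecial n y) (hn : 0 < n) {c : ℤ} (hc : 2 * c = 3 * ((k : ℤ) - 1) - j)
    (u v : ℕ) : y (idx j (cell k u v)) = if (n : ℤ) ∣ 2 * u + v - c then y 0 else -1 := by
  have idx_cell : idx j (cell k u v) = 2 * (2 * u + v - c) := by
    simp only [idx, cell]
    linarith
  rw [idx_cell, hy.apply_two_mul hn]

lemma prod_Icc (hy : IsSpecial n y) (hn : Odd n) :
    ∏ i ∈ Icc (1 : ℤ) (2 * (n : ℤ)), y i = (∏ i ∈ range n, y (1 + 2 * (i : ℤ))) * y 0 := by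
  have periodic_even : Function.Periodic (fun t : ℤ => y (2 * t)) n := fun t => by
    simpa only [mul_add] using hy.periodic (2 * t)
  have eq_neg_one : ∀ i ∈ (range n).erase 0, y (2 * (i : ℤ)) = -1 := fun i hi => by
    rw [mem_erase, mem_range] at hi
    rw [hy.apply_two_mul hn.pos, if_neg]
    exact fun hdvd => hi.1 (Nat.eq_zero_of_dvd_of_lt (Int.natCast_dvd_natCast.1 hdvd) hi.2)
  have prod_even : ∏ i ∈ range n, y (2 * (i : ℤ)) = y 0 := by
    rw [← mul_prod_erase _ _ (mem_range.2 hn.pos), prod_congr rfl eq_neg_one, prod_const,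
      card_erase_of_mem (mem_range.2 hn.pos), card_range, (hn.tsub_odd odd_one).neg_one_pow,
      Nat.cast_zero, mul_zero, mul_one]
  rw [prod_Icc_two_mul, prod_range_add_eq_of_periodic periodic_even, prod_even]

lemma prod_sites (hy : IsSpecial n y) (hn : Odd n) (hj : Odd j) :
    (∏ q ∈ sites n, y (idx j q)) * y 0 ^ n = (∏ i ∈ Icc (1 : ℤ) (2 * (n : ℤ)), y i) ^ n := by
  have periodic_odd : Function.Periodic (fun t : ℤ => y (1 + 2 * t)) n := fun t => by
    simpa only [mul_add, add_assoc] using hy.periodic (1 + 2 * t)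
  have prod_row : ∀ u ∈ range n, ∏ v ∈ range n, y (idx j (cell n u v)) =
      ∏ v ∈ range n, y (1 + 2 * (v : ℤ)) := by
    intro u _
    obtain ⟨i, rfl⟩ := hj
    obtain ⟨l, rfl⟩ := hn
    rw [← prod_range_add_eq_of_periodic periodic_odd (i + 2 * u - 3 * l)]
    refine prod_congr rfl fun v _ => congrArg y ?_
    simp only [idx, cell]
    push_cast
    ring
  rw [Pentagram.prod_sites, prod_congr rfl prod_row, prod_const, card_range, ← mul_pow,
    hy.prod_Icc hn]

end IsSpecial

lemma prod_opposite_corners (hn : 0 < n) :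
    ∏ u ∈ range (n + 1), ∏ v ∈ range (n + 1),
      (if (u = 0 ∧ v = n) ∨ (u = n ∧ v = 0) then (-1 : R) else 1) = 1 := by
  have split_corners : ∀ u v, (if (u = 0 ∧ v = n) ∨ (u = n ∧ v = 0) then (-1 : R) else 1) =
      (if v = n then if u = 0 then -1 else 1 else 1) *
        if v = 0 then if u = n then -1 else 1 else 1 := fun u v => by
    split_ifs <;> first | omega | simp
  simp only [split_corners, prod_mul_distrib, prod_ite_eq', mem_range, n.succ_pos, n.lt_succ_self,
    if_true, mul_neg, mul_one, neg_neg]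

lemma max_east_west_of_eq_add_one {b b' : HeightFunction} (hb : b ∈ heights (n + 1))
    (h : ∀ q, b' q = b q + if q ∈ sites n then 1 else 0) {u v : ℕ} (hu : u < n + 1)
    (hv : v < n + 1) :
    max (b'.east (cell (n + 1) u v)) (b'.west (cell (n + 1) u v)) =
      max (b.east (cell (n + 1) u v)) (b.west (cell (n + 1) u v)) +
        if (u = 0 ∧ v = n) ∨ (u = n ∧ v = 0) then 0 else 1 := by
  have corner_eq : ∀ u v, b'.corner (n + 1) u v = b.corner (n + 1) u v -
      if (0 < u ∧ u < n + 1) ∧ 0 < v ∧ v < n + 1 then 1 else 0 := by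
    intro u v
    rw [corner, corner, h]
    simp only [← vertex_mem_sites, Nat.add_sub_cancel]
    ring
  have corner_le : ∀ u v, b.corner (n + 1) u v ≤ min (u : ℤ) v := fun u v =>
    sub_le_self _ (nonneg_of_mem_heights hb _)
  have boundary := fun u v => corner_boundary (u := u) (v := v) (mem_heights.1 hb).1
  have := corner_le u v
  have := corner_le (u + 1) (v + 1)
  have := boundary u v
  have := boundary (u + 1) (v + 1)
  rw [east_cell, east_cell, west_cell, west_cell, corner_eq, corner_eq]
  split_ifs <;> omega

lemma weight_of_eq_add_one {b b' : HeightFunction} (hb : b ∈ heights (n + 1))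
    (h : ∀ q, b' q = b q + if q ∈ sites n then 1 else 0) :
    weight y j (n + 1) b' = weight y j (n + 1) b *
      ((∏ q ∈ sites n, y (idx j q)) * ∏ u ∈ range (n + 1), ∏ v ∈ range (n + 1),
        if (u = 0 ∧ v = n) ∨ (u = n ∧ v = 0) then 1 else y (idx j (cell (n + 1) u v))) := by
  have nonneg := nonneg_of_mem_heights hb
  rw [weight, weight, mul_mul_mul_comm, Nat.add_sub_cancel, prod_sites _ (n + 1),
    prod_sites _ (n + 1), ← prod_mul_distrib, ← prod_mul_distrib]
  congr 1
  · refine prod_congr rfl fun q hq => ?_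
    rw [h, if_pos hq, Int.toNat_add (nonneg q) one_pos.le, Int.toNat_one, pow_succ]
  · refine prod_congr rfl fun u hu => ?_
    rw [← prod_mul_distrib]
    refine prod_congr rfl fun v hv => ?_
    have max_nonneg : 0 ≤ max (b.east (cell (n + 1) u v)) (b.west (cell (n + 1) u v)) :=
      (nonneg _).trans (le_max_left _ _)
    rw [max_east_west_of_eq_add_one hb h (mem_range.1 hu) (mem_range.1 hv)]
    split_ifs
    · rw [add_zero, mul_one]
    · rw [Int.toNat_add max_nonneg one_pos.le, Int.toNat_one, pow_succ]

namespace IsTransversal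

variable {G : ℕ → ℕ → Prop} {g h : ℕ → ℕ}

lemma ofMatrix_update (hG : IsTransversal n G g h) (h0 : g 0 = 0) (q : ℤ × ℤ) :
    ofMatrix (n + 1) (permMatrix (Function.update g 0 n)) q =
      ofMatrix (n + 1) (permMatrix (Function.update g n n)) q + if q ∈ sites n then 1 else 0 := by
  have sites_eq : sites n = sites (n + 1 - 1) := by rw [Nat.add_sub_cancel]
  rw [sites_eq]
  split_ifs with hq
  · obtain ⟨u, hu, v, hv, rfl⟩ := exists_eq_vertex hq
    obtain ⟨⟨u_pos, u_lt⟩, v_pos, v_lt⟩ := vertex_mem_sites.1 hq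
    have isASM_zero := hG.isASM_permMatrix_update h0 (a := 0) (Or.inl rfl)
    have isASM_last := hG.isASM_permMatrix_update h0 (a := n) (Or.inr rfl)
    have corner_zero := corner_ofMatrix isASM_zero hu hv
    have corner_last := corner_ofMatrix isASM_last hu hv
    simp only [permMatrix, sum_range_single] at corner_zero corner_last
    obtain ⟨u, rfl⟩ := Nat.exists_eq_add_one.2 u_pos
    have sum_eq : ∀ u' ∈ range u, (if Function.update g 0 n (u' + 1) < v then (1 : ℤ) else 0) =
        if Function.update g n n (u' + 1) < v then 1 else 0 := fun u' hu' => by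
      rw [mem_range] at hu'
      rw [Function.update_of_ne (by omega), Function.update_of_ne (by omega)]
    rw [sum_range_succ', Function.update_self, if_neg (by omega), sum_congr rfl sum_eq]
      at corner_zero
    rw [sum_range_succ', Function.update_of_ne hG.pos.ne, h0, if_pos v_pos] at corner_last
    simp only [corner] at corner_zero corner_last
    linarith
  · rw [eq_zero_of_notMem (support_ofMatrix _ _) hq, eq_zero_of_notMem (support_ofMatrix _ _) hq,
      add_zero]

lemma ofMatrix_update_ne (hG : IsTransversal n G g h) (h0 : g 0 = 0) :
    ofMatrix (n + 1) (permMatrix (Function.update g 0 n)) ≠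
      ofMatrix (n + 1) (permMatrix (Function.update g n n)) := by
  intro heq
  have corner_eq := congrArg (matrix · (n + 1) 0 0) heq
  rw [matrix_ofMatrix (hG.isASM_permMatrix_update h0 (Or.inl rfl)) n.succ_pos n.succ_pos,
    matrix_ofMatrix (hG.isASM_permMatrix_update h0 (Or.inr rfl)) n.succ_pos n.succ_pos,
    permMatrix, permMatrix, Function.update_self, Function.update_of_ne hG.pos.ne, h0,
    if_neg hG.pos.ne, if_pos rfl] at corner_eq
  exact zero_ne_one corner_eq

lemma mem_iff_update (hG : IsTransversal n G g h) (h0 : g 0 = 0) {u v : ℕ} (hu : u < n + 1)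
    (hv : v < n + 1) :
    G u v ↔ v = Function.update g n n u ∨ (u = 0 ∧ v = n) ∨ (u = n ∧ v = 0) := by
  have pos := hG.pos
  have zero_mem : G 0 0 := hG.zero_mem_iff.2 h0
  rcases (Nat.lt_succ_iff.1 hu).lt_or_eq with hun | rfl <;>
    rcases (Nat.lt_succ_iff.1 hv).lt_or_eq with hvn | rfl
  · rw [hG.row u v hvn, Function.update_of_ne hun.ne]
    omega
  · have g_lt := hG.g_lt u
    have h_zero := hG.g_zero_iff.1 h0
    rw [hG.right, hG.col u 0 hun, Function.update_of_ne hun.ne]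
    omega
  · rw [hG.bottom, hG.row 0 v hvn, Function.update_self]
    omega
  · rw [hG.bottom, hG.right, Function.update_self]
    exact iff_of_true zero_mem (Or.inl rfl)

lemma prod_off_corners (hG : IsTransversal n G g h) (h0 : g 0 = 0) (hn : Odd n) {f : ℕ → ℕ → R}
    {x : R} (hx : ∀ u v, G u v → f u v = x) (hneg : ∀ u v, ¬ G u v → f u v = -1) :
    ∏ u ∈ range (n + 1), ∏ v ∈ range (n + 1),
      (if (u = 0 ∧ v = n) ∨ (u = n ∧ v = 0) then 1 else f u v) = x ^ (n + 1) := by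
  have pos := hn.pos
  have prod_signed_row : ∀ u, ∏ v ∈ range (n + 1),
      (if v = Function.update g n n u then x else -1) = -x := by
    intro u
    have update_mem : Function.update g n n u ∈ range (n + 1) := mem_range.2 (hG.update_lt u)
    rw [← mul_prod_erase _ _ update_mem, if_pos rfl,
      prod_congr rfl fun v hv => if_neg (ne_of_mem_erase hv), prod_const,
      card_erase_of_mem update_mem, card_range, Nat.add_sub_cancel, hn.neg_one_pow, mul_neg_one]
  calc _ = ∏ u ∈ range (n + 1), ∏ v ∈ range (n + 1),
        (if v = Function.update g n n u then x else -1) *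
          if (u = 0 ∧ v = n) ∨ (u = n ∧ v = 0) then -1 else 1 := by
        refine prod_congr rfl fun u hu => prod_congr rfl fun v hv => ?_
        have mem_iff := hG.mem_iff_update h0 (mem_range.1 hu) (mem_range.1 hv)
        by_cases hcorner : (u = 0 ∧ v = n) ∨ (u = n ∧ v = 0)
        · have ne_update : v ≠ Function.update g n n u := by
            rw [Function.update_apply]
            grind
          rw [if_pos hcorner, if_pos hcorner, if_neg ne_update, neg_mul_neg, one_mul]
        · rw [if_neg hcorner, if_neg hcorner, mul_one]
          rw [or_iff_left hcorner] at mem_iff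
          split_ifs with hv'
          · exact hx u v (mem_iff.2 hv')
          · exact hneg u v (mt mem_iff.1 hv')
    _ = x ^ (n + 1) := by
        simp only [prod_mul_distrib]
        rw [prod_opposite_corners pos, mul_one, prod_congr rfl fun u _ => prod_signed_row u,
          prod_const, card_range, hn.add_one.neg_pow]

end IsTransversal

end Specialization

section Evaluation

open HeightFunction MvPolynomial

variable {R : Type*} [CommRing R] {y : ℤ → R} {j c : ℤ} {k n : ℕ} {g h : ℕ → ℕ}

lemma exists_two_mul_eq_of_odd (hjk : Odd (j + k)) : ∃ c : ℤ, 2 * c = 3 * ((k : ℤ) - 1) - j := by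
  obtain ⟨t, ht⟩ := hjk
  exact ⟨2 * k - 2 - t, by linarith⟩

namespace IsSpecial

lemma apply_idx_cell_of_dvd (hy : IsSpecial n y) (hn : 0 < n)
    (hc : 2 * c = 3 * ((k : ℤ) - 1) - j) {u v : ℕ} (huv : (n : ℤ) ∣ 2 * u + v - c) :
    y (idx j (cell k u v)) = y 0 := by
  rw [hy.apply_idx_cell hn hc, if_pos huv]

lemma apply_idx_cell_of_not_dvd (hy : IsSpecial n y) (hn : 0 < n)
    (hc : 2 * c = 3 * ((k : ℤ) - 1) - j) {u v : ℕ} (huv : ¬ (n : ℤ) ∣ 2 * u + v - c) :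
    y (idx j (cell k u v)) = -1 := by
  rw [hy.apply_idx_cell hn hc, if_neg huv]

lemma dvd_of_apply_idx_cell_ne (hy : IsSpecial n y) (hn : 0 < n)
    (hc : 2 * c = 3 * ((k : ℤ) - 1) - j) {u v : ℕ} (huv : y (idx j (cell k u v)) ≠ -1) :
    (n : ℤ) ∣ 2 * u + v - c :=
  not_imp_comm.1 (hy.apply_idx_cell_of_not_dvd hn hc) huv

lemma aeval_FPoly_eq_of_unique (hy : IsSpecial n y) (hn : 0 < n)
    (hc : 2 * c = 3 * ((k : ℤ) - 1) - j) {α : ℕ → ℕ → ℤ} (hα : IsASM k α)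
    (hone : ∀ u < k, ∀ v < k, α u v = 1 → (n : ℤ) ∣ 2 * u + v - c)
    (hunique : ∀ β, IsASM k β → (∀ u < k, ∀ v < k, β u v = 1 → (n : ℤ) ∣ 2 * u + v - c) →
      ∀ u < k, ∀ v < k, β u v = α u v) :
    aeval y (FPoly j k) = weight y j k (ofMatrix k α) * (1 + y 0) ^ onesCount k α := by
  rw [aeval_FPoly_eq_sum_ofMatrix (s := {()}) (α := fun _ => α) (fun _ _ => hα) (by simp)
    fun β hβ hβone => ⟨(), by simp, hunique β hβ fun u hu v hv h1 =>
      hy.dvd_of_apply_idx_cell_ne hn hc (hβone u hu v hv h1)⟩, sum_singleton,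
    onesProd_eq_pow fun u hu v hv h1 => hy.apply_idx_cell_of_dvd hn hc (hone u hu v hv h1)]

lemma aeval_FPoly_eq_pair (hy : IsSpecial n y) (hc : 2 * c = 3 * (((n + 1 : ℕ) : ℤ) - 1) - j)
    (hG : IsTransversal n (fun u v => (n : ℤ) ∣ 2 * u + v - c) g h) (h0 : g 0 = 0) :
    aeval y (FPoly j (n + 1)) =
      weight y j (n + 1) (ofMatrix (n + 1) (permMatrix (Function.update g 0 n))) *
          (1 + y 0) ^ (n + 1) +
        weight y j (n + 1) (ofMatrix (n + 1) (permMatrix (Function.update g n n))) *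
          (1 + y 0) ^ (n + 1) := by
  have isASM : ∀ a ∈ ({0, n} : Finset ℕ), IsASM (n + 1) (permMatrix (Function.update g a n)) :=
    fun a ha => hG.isASM_permMatrix_update h0 (by simpa using ha)
  have onesProd_eq : ∀ a ∈ ({0, n} : Finset ℕ),
      onesProd y j (n + 1) (permMatrix (Function.update g a n)) = (1 + y 0) ^ (n + 1) := by
    intro a ha
    rw [onesProd_eq_pow (x := y 0), onesCount_permMatrix fun u _ => hG.update_lt u]
    · intro u _ v _ h1
      rw [permMatrix_eq_one_iff.1 h1]
      exact hy.apply_idx_cell_of_dvd hG.pos hc (hG.update_mem h0 (by simpa using ha) u)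
  rw [aeval_FPoly_eq_sum_ofMatrix isASM ?_ ?_, sum_pair hG.pos.ne, onesProd_eq 0 (by simp),
    onesProd_eq n (by simp)]
  · rw [coe_pair, Set.injOn_pair]
    exact fun heq => absurd heq (hG.ofMatrix_update_ne h0)
  · intro β hβ hone
    obtain ⟨a, ha, hβa⟩ := hG.eq_permMatrix_update h0 hβ fun u hu v hv h1 =>
      hy.dvd_of_apply_idx_cell_ne hG.pos hc (hone u hu v hv h1)
    exact ⟨a, by simpa using ha, hβa⟩

lemma weight_update (hy : IsSpecial n y) (hn : Odd n) (hj : Odd j)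
    (hc : 2 * c = 3 * (((n + 1 : ℕ) : ℤ) - 1) - j)
    (hG : IsTransversal n (fun u v => (n : ℤ) ∣ 2 * u + v - c) g h) (h0 : g 0 = 0) :
    weight y j (n + 1) (ofMatrix (n + 1) (permMatrix (Function.update g 0 n))) =
      weight y j (n + 1) (ofMatrix (n + 1) (permMatrix (Function.update g n n))) *
        ((∏ i ∈ Icc (1 : ℤ) (2 * (n : ℤ)), y i) ^ n * y 0) := by
  have mem_heights := ofMatrix_mem_heights (hG.isASM_permMatrix_update h0 (a := n) (Or.inr rfl))
  rw [weight_of_eq_add_one mem_heights (hG.ofMatrix_update h0),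
    hG.prod_off_corners h0 hn (fun _ _ => hy.apply_idx_cell_of_dvd hG.pos hc)
      fun _ _ => hy.apply_idx_cell_of_not_dvd hG.pos hc,
    pow_succ, ← mul_assoc (∏ q ∈ sites n, _), hy.prod_sites hn hj]

end IsSpecial

theorem exists_aeval_FPoly_self (hn : Odd n) (hj : Odd (j + n)) :
    ∃ m : ℤ → ℕ, ∀ (R : Type*) [CommRing R] (y : ℤ → R), IsSpecial n y →
      aeval y (FPoly j n) = (∏ i ∈ Icc (1 : ℤ) (2 * (n : ℤ)), y i ^ m i) * (1 + y 0) ^ n := by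
  obtain ⟨c, hc⟩ := exists_two_mul_eq_of_odd hj
  obtain ⟨g, h, hG⟩ := exists_isTransversal hn c
  obtain ⟨m, hm⟩ := exists_exponents_weight j n (ofMatrix n (permMatrix g))
    (N := 2 * n) (by have := hn.pos; omega)
  refine ⟨m, fun R _ y hy => ?_⟩
  rw [hy.aeval_FPoly_eq_of_unique hn.pos hc hG.isASM_permMatrix
      (fun u _ v _ h1 => permMatrix_eq_one_iff.1 h1 ▸ hG.self_mem u)
      fun β hβ hone => hG.eq_permMatrix hβ hone,
    hm R y hy.periodic, onesCount_permMatrix fun u _ => hG.g_lt u]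

theorem exists_aeval_FPoly_succ (hn : Odd n) (hj : Odd (j + (n + 1 : ℕ))) :
    ∃ m : ℤ → ℕ, ∀ (R : Type*) [CommRing R] (y : ℤ → R), IsSpecial n y →
      ∏ i ∈ Icc (1 : ℤ) (2 * (n : ℤ)), y i = 1 → aeval y (FPoly j (n + 1)) =
        (∏ i ∈ Icc (1 : ℤ) (2 * (n : ℤ)), y i ^ m i) * (1 + y 0) ^ (n + 2) := by
  obtain ⟨c, hc⟩ := exists_two_mul_eq_of_odd hj
  obtain ⟨g, h, hG⟩ := exists_isTransversal hn c
  have two_mul_pos : 0 < 2 * (n : ℤ) := by have := hn.pos; omega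
  by_cases h0 : g 0 = 0
  · obtain ⟨m, hm⟩ := exists_exponents_weight j (n + 1)
      (ofMatrix (n + 1) (permMatrix (Function.update g n n))) two_mul_pos
    refine ⟨m, fun R _ y hy hprod => ?_⟩
    have odd_j : Odd j := (Int.odd_add.1 hj).2 ((Int.even_coe_nat _).2 hn.add_one)
    rw [hy.aeval_FPoly_eq_pair hc hG h0, hy.weight_update hn odd_j hc hG h0, hprod,
      hm R y hy.periodic]
    ring
  · obtain ⟨m, hm⟩ := exists_exponents_weight j (n + 1)
      (ofMatrix (n + 1) (extendedMatrix n g h)) two_mul_pos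
    refine ⟨m, fun R _ y hy _ => ?_⟩
    rw [hy.aeval_FPoly_eq_of_unique hn.pos hc (hG.isASM_extendedMatrix h0) ?_
        fun β hβ hone => hG.eq_extendedMatrix h0 hβ hone,
      hm R y hy.periodic, hG.onesCount_extendedMatrix h0]
    intro u hu v hv h1
    rcases (hG.extendedMatrix_eq_one_iff h0 hu).1 h1 with rfl | ⟨rfl, rfl⟩
    · exact hG.self_mem u
    · exact (hG.right _).2 (hG.symm.self_mem 0)

lemma isUnit_prod_pow_mul_pow {ι : Type*} {s : Finset ι} {f : ι → R} {x : R}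
    (hs : ∏ i ∈ s, f i = 1) (hx : IsUnit x) (m : ι → ℕ) (a : ℕ) :
    IsUnit ((∏ i ∈ s, f i ^ m i) * x ^ a) :=
  have isUnit_apply := IsUnit.prod_iff.1 (hs ▸ isUnit_one)
  (IsUnit.prod_iff.2 fun i hi => (isUnit_apply i hi).pow (m i)).mul (hx.pow a)

end Evaluation

end Pentagram

theorem mainTheorem5_general (n : ℕ) (hn : Odd n) (j : ℤ) (k : ℕ) (hk : k = n ∨ k = n + 1)
    (hjk : Odd (j + (k : ℤ))) :
    ∃ P : MvPolynomial ℤ ℤ,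
      algebraMap Pentagram.YPoly Pentagram.YRat P = Pentagram.F j k ∧
      ∃ m : ℤ → ℕ, ∀ (R : Type*) [CommRing R] (y : ℤ → R),
        (∀ i : ℤ, y (i + 2 * (n : ℤ)) = y i) →
        (∀ i ∈ Pentagram.arithProg 2 (2 * (n : ℤ) - 2) 2, y i = -1) →
          (k = n → MvPolynomial.aeval y P =
            (∏ i ∈ Finset.Icc (1 : ℤ) (2 * (n : ℤ)), y i ^ m i) * (1 + y 0) ^ n) ∧
          (∏ i ∈ Finset.Icc (1 : ℤ) (2 * (n : ℤ)), y i = 1 →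
            (k = n + 1 → MvPolynomial.aeval y P =
              (∏ i ∈ Finset.Icc (1 : ℤ) (2 * (n : ℤ)), y i ^ m i) * (1 + y 0) ^ (n + 2)) ∧
            (IsUnit (1 + y 0) → IsUnit (MvPolynomial.aeval y P))) := by
  refine ⟨Pentagram.FPoly j k, Pentagram.algebraMap_FPoly k j, ?_⟩
  rcases hk with rfl | rfl
  · obtain ⟨m, hm⟩ := Pentagram.exists_aeval_FPoly_self hn hjk
    refine ⟨m, fun R _ y periodic eq_neg_one => ?_⟩
    have value := hm R y ⟨periodic, eq_neg_one⟩
    exact ⟨fun _ => value, fun hprod => ⟨fun h => by omega, fun hunit =>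
      value ▸ Pentagram.isUnit_prod_pow_mul_pow hprod hunit m k⟩⟩
  · obtain ⟨m, hm⟩ := Pentagram.exists_aeval_FPoly_succ hn hjk
    refine ⟨m, fun R _ y periodic eq_neg_one => ⟨fun h => by omega, fun hprod => ?_⟩⟩
    have value := hm R y ⟨periodic, eq_neg_one⟩ hprod
    exact ⟨fun _ => value, fun hunit =>
      value ▸ Pentagram.isUnit_prod_pow_mul_pow hprod hunit m (n + 2)⟩

theorem mainTheorem5 (n : ℕ) (hn : Odd n) (j : ℤ) (k : ℕ) (hk : k = n ∨ k = n + 1)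
    (hjk : Odd (j + (k : ℤ))) :
    ∃ P : MvPolynomial ℤ ℤ,
      algebraMap Pentagram.YPoly Pentagram.YRat P = Pentagram.F j k ∧
      ∃ m : ℤ → ℕ, ∀ (K : Type*) [Field K] (y : ℤ → K),
        (∀ i : ℤ, y (i + 2 * (n : ℤ)) = y i) →
        (∀ i ∈ Pentagram.arithProg 2 (2 * (n : ℤ) - 2) 2, y i = -1) →
        ∏ i ∈ Finset.Icc (1 : ℤ) (2 * (n : ℤ)), y i = 1 →
          (k = n → MvPolynomial.aeval y P =
            (∏ i ∈ Finset.Icc (1 : ℤ) (2 * (n : ℤ)), y i ^ m i) * (1 + y 0) ^ n) ∧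
          (k = n + 1 → MvPolynomial.aeval y P =
            (∏ i ∈ Finset.Icc (1 : ℤ) (2 * (n : ℤ)), y i ^ m i) * (1 + y 0) ^ (n + 2)) ∧
          (y 0 ≠ -1 → (∀ i : ℤ, y i ≠ 0) → MvPolynomial.aeval y P ≠ 0) := by
  obtain ⟨P, hP, m, hm⟩ := mainTheorem5_general n hn j k hk hjk
  refine ⟨P, hP, m, fun K _ y periodic eq_neg_one hprod => ?_⟩
  obtain ⟨value_self, value_succ, isUnit⟩ := (hm K y periodic eq_neg_one).imp_right (· hprod)
  exact ⟨value_self, value_succ, fun h0 _ =>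
    (isUnit (isUnit_iff_ne_zero.2 fun h => h0 (eq_neg_of_add_eq_zero_right h))).ne_zero⟩
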